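/- Let $(Y_k)_{k\in V}$ be a finite family of $N=|V|$ real random variables on a probability space, and let $G$ be an undirected multigraph on $V$ (multiple edges and loops allowed) that is a dependency graph of the family: whenever $V_1,V_2\subset V$ are disjoint and no edge of $G$ has one vertex in $V_1$ and the other in $V_2$, the families $(Y_k)_{k\in V_1}$ and $(Y_k)_{k\in V_2}$ are independent. Let $D$ be the maximal degree of $G$, the degree of a vertex being the number of edges (counted with multiplicity) to which it belongs. Let $(c_k)_{k\in V}$ be arbitrary real numbers, and put $$S=\sum_{k\in V}Y_k,\qquad v=\sqrt{\mathrm{Var}[S]},\qquad W=\frac{S-\mathbb E[S]}{v},$$ $$\mathcal A_\delta=\sum_{k\in V}\mathbb E\big[|Y_k-c_k|^\delta\big],\qquad \xi_\delta=\Big(\frac{N}{\mathcal A_\delta}\Big)^{1/\delta}\sqrt{\frac{\mathrm{Var}[S]}{N(D+1)}}.$$ Assume that $v>0$ and that $\mathcal A_\delta<\infty$ for some $\delta\in[3,\infty)$. Then $$d_{\mathrm{Kol}}\big(W,\mathcal N(0,1)\big)\le\max\left\{18.96\,\xi_\delta^{-\frac{\delta}{\delta+1}}\Big(\frac{D+1}{N}\Big)^{\frac{\delta-2}{2(\delta+1)}},\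 \frac{227.5}{\xi_\delta^{3}}\sqrt{\frac{D+1}{N}}\right\},$$ where $d_{\mathrm{Kol}}(W,\mathcal N(0,1))=\sup_{t\in\mathbb R}\big|\mathbb P(W\le t)-\mathcal N(0,1)((-\infty,t])\big|$. -/

import Mathlib

open MeasureTheory ProbabilityTheory

/-- An undirected multigraph on the vertex set `V`: its edges form a multiset of unordered pairs
of vertices; multiple edges and loops are allowed. -/
structure Multigraph (V : Type*) where
  edges : Multiset (Sym2 V)

open Classical in
/-- The degree of a vertex: the number of edges, counted with multiplicity, to which it belongs. -/
noncomputable def Multigraph.degree {V : Type*} (G : Multigraph V) (k : V) : ℕ :=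
  (G.edges.filter (fun e => k ∈ e)).card

/-- The maximal degree of a multigraph on a finite vertex set. -/
noncomputable def Multigraph.maxDegree {V : Type*} [Fintype V] (G : Multigraph V) : ℕ :=
  Finset.univ.sup G.degree

/-- `G` is a dependency graph of the family `(Y k)`: whenever `V₁`, `V₂` are disjoint sets of
vertices and no edge of `G` has one vertex in `V₁` and the other one in `V₂`, the families
`(Y k)_{k ∈ V₁}` and `(Y k)_{k ∈ V₂}` are independent. -/
def IsDependencyGraph {V Ω : Type*} [MeasurableSpace Ω] (G : Multigraph V) (Y : V → Ω → ℝ)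
    (P : Measure Ω) : Prop :=
  ∀ V₁ V₂ : Finset V, Disjoint V₁ V₂ →
    (∀ i ∈ V₁, ∀ j ∈ V₂, s(i, j) ∉ G.edges) →
    IndepFun (fun ω (k : V₁) => Y k ω) (fun ω (k : V₂) => Y k ω) P

/-- The Kolmogorov distance `sup_t |μ((-∞, t]) - ν((-∞, t])|` of two probability measures. -/
noncomputable def kolmogorovDist (μ ν : Measure ℝ) : ℝ :=
  ⨆ t : ℝ, |μ.real (Set.Iic t) - ν.real (Set.Iic t)|

section

variable {V Ω : Type*} [Fintype V] [MeasurableSpace Ω]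

/-- The sum `S = ∑ k, Y k`. -/
noncomputable def totalSum (Y : V → Ω → ℝ) (ω : Ω) : ℝ := ∑ k, Y k ω

/-- The standard deviation `v` of `S`. -/
noncomputable def sumStdDev (Y : V → Ω → ℝ) (P : Measure Ω) : ℝ :=
  √(variance (totalSum Y) P)

/-- The normalized sum `W = (S - E[S]) / v`. -/
noncomputable def normalizedSum (Y : V → Ω → ℝ) (P : Measure Ω) (ω : Ω) : ℝ :=
  (totalSum Y ω - ∫ ω', totalSum Y ω' ∂P) / sumStdDev Y P

/-- `A_δ = ∑ k, E[|Y k - c k| ^ δ]`, as an element of `[0, ∞]`. -/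
noncomputable def momentSum (Y : V → Ω → ℝ) (c : V → ℝ) (P : Measure Ω) (δ : ℝ) : ENNReal :=
  ∑ k, ∫⁻ ω, ENNReal.ofReal (|Y k ω - c k| ^ δ) ∂P

/-- The renormalized standard deviation
`ξ_δ = (N / A_δ) ^ (1 / δ) * √(Var[S] / (N * (D + 1)))`, where `N` is the number of variables. -/
noncomputable def renormStdDev (Y : V → Ω → ℝ) (c : V → ℝ) (P : Measure Ω) (D : ℕ) (δ : ℝ) : ℝ :=
  ((Fintype.card V : ℝ) / (momentSum Y c P δ).toReal) ^ (1 / δ) *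
    √(variance (totalSum Y) P / ((Fintype.card V : ℝ) * ((D : ℝ) + 1)))

end

/-! The proof combines Stein's method for bounded variables with truncation. Put `m = D + 1`. For
centered `X i` with `|X i| ≤ B` and sum `W`, let `η i` be the sum over the closed neighbourhood of
`i`, so that `X i` is independent of `W - η i`. If `f' - w f = h - E h(Z)` with `Z` standard
Gaussian, and `Q = ∑ X i * η i`, then `E h(W) - E h(Z)` splits into `E[f'(W)(1 - Q)]`, controlled by
`|1 - E W²|` and the variance of `Q`, and a second order Taylor remainder
(`IsDependencyGraph.abs_integral_rampDown_sub_le`).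

The test function `h` is a ramp of width `α`. Its slope `1 / α` matters only when `W` lies near the
ramp. After decoupling, this means a window of length `α + 6 m B`, whose probability is at most the
Gaussian bound plus `2 Δ`, where `Δ` is the Kolmogorov distance being estimated. Hence `Δ` is at
most explicit terms plus a fraction of itself, even when `α` is only proportional to the target
bound (`IsDependencyGraph.kolmogorovDist_le_of_bounded`).

In general `Y k - c k` is truncated at `L = e v / m`, with `e` solving `A = m e L ^ δ`. This
balances the two costs of truncation: the bound `m B` on neighbourhood sums and the effect of the
discarded part on the distribution function are both of order `e`
(`IsDependencyGraph.kolmogorovDist_normalizedSum_le`). The two terms of the maximum are multiples of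
this `e` and of the third moment ratio `y`, estimated by the power mean inequality. If the maximum
`θ` is at least `1` the claim is trivial; otherwise every error is at most a multiple of `θ`, and
the numerical constants add up to less than `θ`. -/

/-! ### Gaussian tails and Stein's equation -/

lemma integrable_exp_neg_sq_div_two : Integrable fun x : ℝ => Real.exp (-x ^ 2 / 2) := by
  have h := integrable_exp_neg_mul_sq (b := 1 / 2) (by norm_num)
  refine h.congr (Filter.Eventually.of_forall fun x => ?_)
  simp only
  congr 1
  ring

lemma integral_Ioi_exp_neg_sq_div_two_nonneg (w : ℝ) :
    0 ≤ ∫ x in Set.Ioi w, Real.exp (-x ^ 2 / 2) :=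
  integral_nonneg fun _ => (Real.exp_pos _).le

/-- A Gaussian tail bound. -/
lemma integral_Ioi_exp_neg_sq_div_two_le {w : ℝ} (hw : 0 ≤ w) :
    ∫ x in Set.Ioi w, Real.exp (-x ^ 2 / 2) ≤ 1.26 * Real.exp (-w ^ 2 / 2) := by
  have h1 := (measurePreserving_add_right volume w).setIntegral_preimage_emb
    (measurableEmbedding_addRight w) (fun x : ℝ => Real.exp (-x ^ 2 / 2)) (Set.Ioi w)
  rw [← h1, Set.preimage_add_const_Ioi, sub_self]
  have hint := integrable_exp_neg_sq_div_two
  have h2 : ∫ x in Set.Ioi (0 : ℝ), Real.exp (-x ^ 2 / 2) = √(2 * Real.pi) / 2 := by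
    have := integral_gaussian_Ioi (1 / 2)
    rw [show Real.pi / (1 / 2) = 2 * Real.pi by ring] at this
    rw [← this]
    congr 1
    ext x
    congr 1
    ring
  calc ∫ x in Set.Ioi (0 : ℝ), Real.exp (-(x + w) ^ 2 / 2)
      ≤ ∫ x in Set.Ioi (0 : ℝ), Real.exp (-w ^ 2 / 2) * Real.exp (-x ^ 2 / 2) := by
        refine setIntegral_mono_on (hint.comp_add_right w).integrableOn
          (hint.const_mul _).integrableOn measurableSet_Ioi fun x hx => ?_
        rw [← Real.exp_add, Real.exp_le_exp]
        nlinarith [mul_nonneg (le_of_lt (Set.mem_Ioi.1 hx)) hw]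
    _ = Real.exp (-w ^ 2 / 2) * (√(2 * Real.pi) / 2) := by rw [integral_const_mul, h2]
    _ ≤ 1.26 * Real.exp (-w ^ 2 / 2) := by
        -- The constant 1.26 is `√(π / 2)` rounded up.
        have : √(2 * Real.pi) ≤ 2.52 := by
          rw [Real.sqrt_le_left (by norm_num)]
          nlinarith [Real.pi_lt_d2]
        nlinarith [Real.exp_pos (-w ^ 2 / 2)]

/-- The Mills ratio bound. -/
lemma mul_integral_Ioi_exp_neg_sq_div_two_le (w : ℝ) :
    w * ∫ x in Set.Ioi w, Real.exp (-x ^ 2 / 2) ≤ Real.exp (-w ^ 2 / 2) := by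
  rcases le_total w 0 with hw | hw
  · exact (mul_nonpos_of_nonpos_of_nonneg hw (integral_Ioi_exp_neg_sq_div_two_nonneg w)).trans
      (Real.exp_pos _).le
  have hd : ∀ x ∈ Set.Ici w, HasDerivAt (fun x : ℝ => -Real.exp (-x ^ 2 / 2))
      (x * Real.exp (-x ^ 2 / 2)) x := by
    intro x _
    have h : HasDerivAt (fun x : ℝ => -x ^ 2 / 2) (-x) x := by
      have := ((hasDerivAt_pow 2 x).neg).div_const 2
      refine this.congr_deriv ?_
      simp only [Nat.cast_ofNat]
      ring
    refine h.exp.neg.congr_deriv ?_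
    ring
  have ht : Filter.Tendsto (fun x : ℝ => -Real.exp (-x ^ 2 / 2)) Filter.atTop (nhds 0) := by
    rw [← neg_zero]
    refine (Real.tendsto_exp_atBot.comp ?_).neg
    have : Filter.Tendsto (fun x : ℝ => x ^ 2 / 2) Filter.atTop Filter.atTop :=
      (Filter.tendsto_pow_atTop two_ne_zero).atTop_div_const two_pos
    refine (Filter.tendsto_neg_atTop_atBot.comp this).congr fun x => ?_
    simp [neg_div]
  have hpos : ∀ x ∈ Set.Ioi w, 0 ≤ x * Real.exp (-x ^ 2 / 2) := fun x hx =>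
    mul_nonneg (hw.trans (le_of_lt hx)) (Real.exp_pos _).le
  have hi := integrableOn_Ioi_deriv_of_nonneg' hd hpos ht
  have he := integral_Ioi_of_hasDerivAt_of_tendsto' hd hi ht
  rw [← integral_const_mul]
  calc ∫ x in Set.Ioi w, w * Real.exp (-x ^ 2 / 2)
      ≤ ∫ x in Set.Ioi w, x * Real.exp (-x ^ 2 / 2) := by
        refine setIntegral_mono_on (integrable_exp_neg_sq_div_two.const_mul w).integrableOn hi
          measurableSet_Ioi fun x hx => ?_
        exact mul_le_mul_of_nonneg_right (le_of_lt hx) (Real.exp_pos _).le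
    _ = Real.exp (-w ^ 2 / 2) := by rw [he]; ring

/-- As `g` has integral zero, the integral over `(-∞, w]` can be traded for the one over the
complement; the half-line not containing the origin gives a tail at `|w|`. -/
lemma abs_integral_Iic_le_integral_Ioi_abs {g : ℝ → ℝ} (hg : Integrable g)
    (hb : ∀ x, |g x| ≤ Real.exp (-x ^ 2 / 2)) (h0 : ∫ x, g x = 0) (w : ℝ) :
    |∫ x in Set.Iic w, g x| ≤ ∫ x in Set.Ioi |w|, Real.exp (-x ^ 2 / 2) := by
  have hint := integrable_exp_neg_sq_div_two
  have key : ∀ s : Set ℝ, MeasurableSet s →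
      |∫ x in s, g x| ≤ ∫ x in s, Real.exp (-x ^ 2 / 2) := by
    intro s hs
    refine (abs_integral_le_integral_abs).trans ?_
    exact setIntegral_mono_on hg.abs.integrableOn hint.integrableOn hs fun x _ => hb x
  rcases le_total 0 w with hw | hw
  · have h1 := integral_add_compl (s := Set.Iic w) measurableSet_Iic hg
    rw [h0, Set.compl_Iic] at h1
    rw [eq_neg_of_add_eq_zero_left h1, abs_neg, abs_of_nonneg hw]
    exact key _ measurableSet_Ioi
  · rw [abs_of_nonpos hw]
    refine (key _ measurableSet_Iic).trans (le_of_eq ?_)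
    have := integral_comp_neg_Ioi (-w) (fun x : ℝ => Real.exp (-x ^ 2 / 2))
    simp only [neg_neg] at this
    rw [← this]
    simp

lemma integral_gaussianReal_zero_one (h : ℝ → ℝ) :
    ∫ x, h x ∂(gaussianReal 0 1) = (√(2 * Real.pi))⁻¹ * ∫ x, Real.exp (-x ^ 2 / 2) * h x := by
  rw [integral_gaussianReal_eq_integral_smul one_ne_zero, ← integral_const_mul]
  congr 1
  ext x
  simp [gaussianPDFReal, mul_assoc]

/-- The solution of Stein's equation `f' - w f = h - E[h(Z)]` for a continuous test function with
values in `[0, 1]`. -/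
theorem exists_stein_solution {h : ℝ → ℝ} (hc : Continuous h) (h0 : ∀ x, 0 ≤ h x)
    (h1 : ∀ x, h x ≤ 1) :
    ∃ f f' : ℝ → ℝ, (∀ w, HasDerivAt f (f' w) w) ∧
      (∀ w, f' w = w * f w + (h w - ∫ x, h x ∂(gaussianReal 0 1))) ∧
      (∀ w, |f w| ≤ 1.26) ∧ ∀ w, |f' w| ≤ 2 := by
  set c := ∫ x, h x ∂(gaussianReal 0 1) with hcdef
  have hint := integrable_exp_neg_sq_div_two
  have hc01 : 0 ≤ c ∧ c ≤ 1 := by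
    refine ⟨integral_nonneg h0, ?_⟩
    have hhi : Integrable h (gaussianReal 0 1) :=
      Integrable.of_bound hc.aestronglyMeasurable 1
        (Filter.Eventually.of_forall fun x => by rw [Real.norm_eq_abs, abs_of_nonneg (h0 x)]; exact h1 x)
    calc c ≤ ∫ x, (1 : ℝ) ∂(gaussianReal 0 1) := integral_mono hhi (integrable_const _) h1
      _ = 1 := by simp
  have hhc : ∀ x, |h x - c| ≤ 1 := fun x => by
    rw [abs_le]; constructor <;> linarith [h0 x, h1 x, hc01.1, hc01.2]
  set g : ℝ → ℝ := fun x => Real.exp (-x ^ 2 / 2) * (h x - c) with hgdef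
  have hgc : Continuous g := by fun_prop
  have hgb : ∀ x, |g x| ≤ Real.exp (-x ^ 2 / 2) := fun x => by
    rw [hgdef, abs_mul, abs_of_pos (Real.exp_pos _)]
    exact mul_le_of_le_one_right (Real.exp_pos _).le (hhc x)
  have hgi : Integrable g := hint.mono' hgc.aestronglyMeasurable
    (Filter.Eventually.of_forall fun x => by simpa using hgb x)
  have hg0 : ∫ x, g x = 0 := by
    have e1 : ∫ x, (h x - c) ∂(gaussianReal 0 1) = 0 := by
      rw [integral_sub _ (integrable_const _)]
      · simp [← hcdef]
      · exact Integrable.of_bound hc.aestronglyMeasurable 1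
          (Filter.Eventually.of_forall fun x => by
            rw [Real.norm_eq_abs, abs_of_nonneg (h0 x)]; exact h1 x)
    rw [integral_gaussianReal_zero_one] at e1
    have : (√(2 * Real.pi))⁻¹ ≠ 0 := by positivity
    exact (mul_eq_zero.1 e1).resolve_left this
  -- The solution is `f w = exp (w² / 2) * F w`, by the integrating factor of the equation.
  set F : ℝ → ℝ := fun w => ∫ x in Set.Iic w, g x with hF
  have hFd : ∀ w, HasDerivAt F (g w) w := by
    intro w
    have e : F = fun u => (∫ x in (0 : ℝ)..u, g x) + F 0 := by
      ext u
      rw [← intervalIntegral.integral_Iic_sub_Iic hgi.integrableOn hgi.integrableOn]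
      simp [hF]
    rw [e]
    exact (intervalIntegral.integral_hasDerivAt_right hgi.intervalIntegrable
      (hgc.stronglyMeasurableAtFilter _ _) hgc.continuousAt).add_const _
  have hFb : ∀ w, |F w| ≤ ∫ x in Set.Ioi |w|, Real.exp (-x ^ 2 / 2) :=
    abs_integral_Iic_le_integral_Ioi_abs hgi hgb hg0
  have hexp : ∀ w : ℝ, Real.exp (w ^ 2 / 2) * Real.exp (-w ^ 2 / 2) = 1 := fun w => by
    rw [← Real.exp_add]; simp [neg_div]
  have hfd : ∀ w, HasDerivAt (fun w => Real.exp (w ^ 2 / 2) * F w)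
      (w * (Real.exp (w ^ 2 / 2) * F w) + (h w - c)) w := by
    intro w
    have hq : HasDerivAt (fun x : ℝ => x ^ 2 / 2) w w := by
      refine ((hasDerivAt_pow 2 w).div_const 2).congr_deriv ?_
      simp
    refine (hq.exp.mul (hFd w)).congr_deriv ?_
    simp only [hgdef]
    rw [← mul_assoc (Real.exp (w ^ 2 / 2)), hexp]
    ring
  -- The Mills ratio bounds `w f` by 1; with `|h - c| ≤ 1` the equation then bounds `f'` by 2.
  have hwf : ∀ w, |w * (Real.exp (w ^ 2 / 2) * F w)| ≤ 1 := by
    intro w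
    have e1 := mul_integral_Ioi_exp_neg_sq_div_two_le |w|
    rw [sq_abs] at e1
    rw [mul_left_comm, abs_mul, abs_of_pos (Real.exp_pos _), abs_mul, ← hexp w]
    exact mul_le_mul_of_nonneg_left
      ((mul_le_mul_of_nonneg_left (hFb w) (abs_nonneg _)).trans e1) (Real.exp_pos _).le
  refine ⟨_, _, hfd, fun _ => rfl, fun w => ?_, fun w => ?_⟩
  · have e1 := (hFb w).trans (integral_Ioi_exp_neg_sq_div_two_le (abs_nonneg w))
    rw [sq_abs] at e1
    rw [abs_mul, abs_of_pos (Real.exp_pos _)]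
    calc _ ≤ Real.exp (w ^ 2 / 2) * (1.26 * Real.exp (-w ^ 2 / 2)) :=
          mul_le_mul_of_nonneg_left e1 (Real.exp_pos _).le
      _ = 1.26 := by rw [mul_left_comm, hexp, mul_one]
  · refine (abs_add_le _ _).trans ?_
    linarith [hwf w, hhc w]

lemma gaussianReal_real_Ioc_le {a b : ℝ} (hab : a ≤ b) :
    (gaussianReal 0 1).real (Set.Ioc a b) ≤ 0.4 * (b - a) := by
  rw [measureReal_def, gaussianReal_apply_eq_integral 0 one_ne_zero,
    ENNReal.toReal_ofReal (integral_nonneg fun x => gaussianPDFReal_nonneg _ _ _)]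
  have hb : ∀ x : ℝ, gaussianPDFReal 0 1 x ≤ 0.4 := by
    intro x
    -- The maximum of the Gaussian density; this is the source of every later 0.4.
    have h1 : (√(2 * Real.pi))⁻¹ ≤ 0.4 := by
      rw [inv_le_comm₀ (by positivity) (by norm_num)]
      apply Real.le_sqrt_of_sq_le
      nlinarith [Real.pi_gt_d4]
    have h2 : Real.exp (-x ^ 2 / 2) ≤ 1 := by
      rw [Real.exp_le_one_iff]
      nlinarith [sq_nonneg x]
    have h3 : (0 : ℝ) ≤ (√(2 * Real.pi))⁻¹ := by positivity
    simp only [gaussianPDFReal, sub_zero, NNReal.coe_one, mul_one]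
    nlinarith
  calc ∫ x in Set.Ioc a b, gaussianPDFReal 0 1 x ≤ ∫ x in Set.Ioc a b, (0.4 : ℝ) :=
        setIntegral_mono_on (integrable_gaussianPDFReal 0 1).integrableOn (by simp)
          measurableSet_Ioc fun x _ => hb x
    _ = 0.4 * (b - a) := by simp [hab, mul_comm]

lemma gaussianReal_real_Iic_sub {a b : ℝ} (hab : a ≤ b) :
    (gaussianReal 0 1).real (Set.Iic b) - (gaussianReal 0 1).real (Set.Iic a)
      = (gaussianReal 0 1).real (Set.Ioc a b) := by
  rw [← Set.Iic_union_Ioc_eq_Iic hab, measureReal_union (by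
    rw [Set.disjoint_left]; intro x hx hx'; exact absurd hx'.1 (not_lt.2 hx)) measurableSet_Ioc]
  ring

lemma gaussianReal_real_Iic_le {a b : ℝ} (hab : a ≤ b) :
    (gaussianReal 0 1).real (Set.Iic b) ≤ (gaussianReal 0 1).real (Set.Iic a) + 0.4 * (b - a) := by
  linarith [gaussianReal_real_Iic_sub hab, gaussianReal_real_Ioc_le hab]

/-! ### Ramp test functions and their Stein solutions -/

/-- The continuous piecewise linear function equal to `1` on `(-∞, z]` and to `0` on
`[z + α, ∞)`. -/
noncomputable def rampDown (z α x : ℝ) : ℝ := max 0 (min 1 ((z + α - x) / α))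

lemma continuous_rampDown (z α : ℝ) : Continuous (rampDown z α) := by
  unfold rampDown
  fun_prop

lemma rampDown_nonneg (z α x : ℝ) : 0 ≤ rampDown z α x := le_max_left _ _

lemma rampDown_le_one (z α x : ℝ) : rampDown z α x ≤ 1 := max_le zero_le_one (min_le_left _ _)

lemma rampDown_of_le {z α x : ℝ} (hα : 0 < α) (hx : x ≤ z) : rampDown z α x = 1 := by
  have : 1 ≤ (z + α - x) / α := by rw [le_div_iff₀ hα]; linarith
  simp [rampDown, min_eq_left this]

lemma rampDown_of_ge {z α x : ℝ} (hα : 0 < α) (hx : z + α ≤ x) : rampDown z α x = 0 := by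
  have : (z + α - x) / α ≤ 0 := div_nonpos_of_nonpos_of_nonneg (by linarith) hα.le
  exact max_eq_left ((min_le_right _ _).trans this)

lemma abs_rampDown_sub_le {α : ℝ} (hα : 0 < α) (z x y : ℝ) :
    |rampDown z α x - rampDown z α y| ≤ |x - y| / α := by
  unfold rampDown
  rw [max_comm 0, max_comm 0, min_comm 1, min_comm 1]
  refine (abs_max_sub_max_le_abs _ _ _).trans ((abs_inf_sub_inf_le_abs _ _ _).trans (le_of_eq ?_))
  rw [← sub_div, abs_div, abs_of_pos hα]
  congr 1
  rw [show z + α - x - (z + α - y) = -(x - y) by ring, abs_neg]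

/-- The Lipschitz bound is needed only near the ramp: outside the window both points lie on the same
constant piece. This localization is what later lets the factor `1 / α` be paid only with small
probability. -/
lemma abs_rampDown_sub_sub_le {α b : ℝ} (hα : 0 < α) (z w t : ℝ) (ht : |t| ≤ b) :
    |rampDown z α (w - t) - rampDown z α w|
      ≤ |t| * (1 / α * (Set.Icc (z - b) (z + α + b)).indicator 1 w) := by
  obtain ⟨ht1, ht2⟩ := abs_le.1 ht
  by_cases hw : w ∈ Set.Icc (z - b) (z + α + b)
  · rw [Set.indicator_of_mem hw]
    refine (abs_rampDown_sub_le hα _ _ _).trans (le_of_eq ?_)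
    rw [show w - t - w = -t by ring, abs_neg, Pi.one_apply]
    ring
  · rw [Set.indicator_of_notMem hw, mul_zero, mul_zero]
    rw [Set.mem_Icc, not_and_or, not_le, not_le] at hw
    rcases hw with hw | hw
    · rw [rampDown_of_le hα (by linarith), rampDown_of_le hα (by linarith)]; simp
    · rw [rampDown_of_ge hα (by linarith), rampDown_of_ge hα (by linarith)]; simp

/-- Second order Taylor bound for a function whose derivative is Lipschitz at `w`. -/
lemma abs_taylor_le {f f' : ℝ → ℝ} (hf : ∀ x, HasDerivAt f (f' x) x) {w η C : ℝ}
    (hC : ∀ t, |t| ≤ |η| → |f' (w - t) - f' w| ≤ |t| * C) :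
    |f w - f (w - η) - η * f' w| ≤ η ^ 2 * C / 2 := by
  have hp : ∀ u : ℝ, HasDerivAt (fun u => f w - f (w - u * η) - u * (η * f' w))
      (η * (f' (w - u * η) - f' w)) u := by
    intro u
    have h1 : HasDerivAt (fun u : ℝ => w - u * η) (-η) u := by
      simpa using ((hasDerivAt_id u).mul_const η).const_sub w
    have h2 := (((hf _).comp u h1).const_sub (f w)).sub ((hasDerivAt_id u).mul_const (η * f' w))
    refine h2.congr_deriv ?_
    ring
  have hB : ∀ u : ℝ, HasDerivAt (fun u : ℝ => η ^ 2 * C / 2 * u ^ 2) (η ^ 2 * C * u) u := by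
    intro u
    refine ((hasDerivAt_pow 2 u).const_mul (η ^ 2 * C / 2)).congr_deriv ?_
    simp only [Nat.cast_ofNat]
    ring
  -- Along the segment `w - u η`, the derivative in `u` of the remainder is at most `η² C u`.
  have := image_norm_le_of_norm_deriv_right_le_deriv_boundary (a := 0) (b := 1)
    (f := fun u => f w - f (w - u * η) - u * (η * f' w))
    (fun u _ => (hp u).continuousAt.continuousWithinAt)
    (fun u _ => (hp u).hasDerivWithinAt) (by simp) hB
    (fun u hu => by
      have hu0 : 0 ≤ u := hu.1
      have e1 : |u * η| ≤ |η| := by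
        rw [abs_mul, abs_of_nonneg hu0]
        exact mul_le_of_le_one_left (abs_nonneg _) hu.2.le
      rw [Real.norm_eq_abs, abs_mul]
      calc |η| * |f' (w - u * η) - f' w| ≤ |η| * (|u * η| * C) :=
            mul_le_mul_of_nonneg_left (hC _ e1) (abs_nonneg _)
        _ = η ^ 2 * C * u := by
            rw [abs_mul, abs_of_nonneg hu0, ← sq_abs η]; ring)
    (Set.right_mem_Icc.2 zero_le_one)
  simpa using this

/-- The Stein solution for a ramp, with a pointwise bound for its second order Taylor
remainder. -/
theorem exists_stein_solution_rampDown {α : ℝ} (hα : 0 < α) (z b : ℝ) :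
    ∃ f f' : ℝ → ℝ, Continuous f ∧ Continuous f' ∧
      (∀ w, f' w - w * f w = rampDown z α w - ∫ x, rampDown z α x ∂(gaussianReal 0 1)) ∧
      (∀ w, |f' w| ≤ 2) ∧
      ∀ w η, |η| ≤ b → |f w - f (w - η) - η * f' w| ≤ η ^ 2 *
        (1.26 + 2 * |w| + 1 / α * (Set.Icc (z - b) (z + α + b)).indicator 1 w) / 2 := by
  obtain ⟨f, f', hf, he, hb0, hb1⟩ := exists_stein_solution (continuous_rampDown z α)
    (rampDown_nonneg z α) (rampDown_le_one z α)
  have hfc : Continuous f := continuous_iff_continuousAt.2 fun x => (hf x).continuousAt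
  refine ⟨f, f', hfc, ?_, fun w => by rw [he w]; ring, hb1, fun w η hη => ?_⟩
  · rw [funext he]
    have := continuous_rampDown z α
    fun_prop
  · refine abs_taylor_le hf fun t ht => ?_
    have hlip : |f (w - t) - f w| ≤ 2 * |t| := by
      have := Convex.norm_image_sub_le_of_norm_hasDerivWithin_le (s := Set.univ) (x := w)
        (y := w - t) (fun x _ => (hf x).hasDerivWithinAt) (fun x _ => hb1 x) convex_univ
        (Set.mem_univ _) (Set.mem_univ _)
      simpa using this
    have hr := abs_rampDown_sub_sub_le hα z w t (ht.trans hη)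
    -- Stein's equation at both points: `f` is 2-Lipschitz, bounded by 1.26, and the ramp increment
    -- is local. These give the three terms of the weight.
    have hd : f' (w - t) - f' w = w * (f (w - t) - f w) + -(t * f (w - t))
        + (rampDown z α (w - t) - rampDown z α w) := by
      rw [he, he]; ring
    rw [hd]
    refine (abs_add_three _ _ _).trans ?_
    rw [abs_neg, abs_mul, abs_mul]
    nlinarith [mul_le_mul_of_nonneg_left hlip (abs_nonneg w),
      mul_le_mul_of_nonneg_left (hb0 (w - t)) (abs_nonneg t)]

/-! ### Neighbourhoods, counting and independence in dependency graphs -/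

lemma IsDependencyGraph.comp {V Ω : Type*} [MeasurableSpace Ω] {P : Measure Ω}
    {G : Multigraph V} {Y : V → Ω → ℝ} (hG : IsDependencyGraph G Y P)
    {g : V → ℝ → ℝ} (hg : ∀ k, Measurable (g k)) :
    IsDependencyGraph G (fun k ω => g k (Y k ω)) P := by
  intro V₁ V₂ hd he
  have h := hG V₁ V₂ hd he
  exact h.comp (φ := fun (x : V₁ → ℝ) (k : V₁) => g k (x k))
    (ψ := fun (x : V₂ → ℝ) (k : V₂) => g k (x k))
    (measurable_pi_lambda _ fun k => (hg k).comp (measurable_pi_apply k))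
    (measurable_pi_lambda _ fun k => (hg k).comp (measurable_pi_apply k))

section

variable {V Ω : Type*} [Fintype V] [MeasurableSpace Ω]

open Classical in
/-- The closed neighbourhood of a vertex. -/
noncomputable def Multigraph.nbhd (G : Multigraph V) (i : V) : Finset V :=
  Finset.univ.filter fun j => j = i ∨ s(i, j) ∈ G.edges

lemma Multigraph.mem_nbhd {G : Multigraph V} {i j : V} :
    j ∈ G.nbhd i ↔ j = i ∨ s(i, j) ∈ G.edges := by
  simp [Multigraph.nbhd]

lemma Multigraph.self_mem_nbhd (G : Multigraph V) (i : V) : i ∈ G.nbhd i :=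
  mem_nbhd.2 (Or.inl rfl)

lemma Multigraph.mem_nbhd_comm {G : Multigraph V} {i j : V} : j ∈ G.nbhd i ↔ i ∈ G.nbhd j := by
  rw [mem_nbhd, mem_nbhd, Sym2.eq_swap, eq_comm]

lemma Multigraph.card_nbhd_le (G : Multigraph V) (i : V) :
    (G.nbhd i).card ≤ G.maxDegree + 1 := by
  classical
  -- Erasing `i` and adding it back makes loops harmless; multiple edges only increase the degree.
  have h1 : (G.nbhd i).erase i ⊆ Finset.univ.filter fun j => s(i, j) ∈ G.edges := by
    intro j hj
    rw [Finset.mem_erase, mem_nbhd] at hj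
    simpa using hj.2.resolve_left hj.1
  have h2 : (Finset.univ.filter fun j => s(i, j) ∈ G.edges).card ≤ G.degree i := by
    calc _ ≤ ((G.edges.filter fun e => i ∈ e).toFinset).card := by
          refine Finset.card_le_card_of_injOn (fun j => s(i, j)) (fun j hj => ?_)
            (fun a _ b _ hab => Sym2.congr_right.1 hab)
          simpa using hj
      _ ≤ _ := by
          unfold Multigraph.degree
          convert Multiset.toFinset_card_le _
  have h3 : G.degree i ≤ G.maxDegree := Finset.le_sup (f := G.degree) (Finset.mem_univ i)
  have h4 := Finset.card_erase_add_one (G.self_mem_nbhd i)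
  have h5 := Finset.card_le_card h1
  omega

lemma Multigraph.sum_sum_nbhd_comm (G : Multigraph V) (F : V → V → ℝ) :
    ∑ i, ∑ j ∈ G.nbhd i, F i j = ∑ j, ∑ i ∈ G.nbhd j, F i j := by
  refine Finset.sum_comm' fun i j => ?_
  simp [Multigraph.mem_nbhd_comm (i := i)]

lemma Multigraph.sum_sum_nbhd_le (G : Multigraph V) {M : ℝ} (hM : ∀ i, ((G.nbhd i).card : ℝ) ≤ M)
    {F : V → ℝ} (hF : ∀ i, 0 ≤ F i) : ∑ i, ∑ j ∈ G.nbhd i, F j ≤ M * ∑ i, F i := by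
  rw [G.sum_sum_nbhd_comm fun _ j => F j, Finset.mul_sum]
  refine Finset.sum_le_sum fun j _ => ?_
  rw [Finset.sum_const, nsmul_eq_mul]
  exact mul_le_mul_of_nonneg_right (hM j) (hF j)

lemma Multigraph.sum_sum_nbhd_le' (G : Multigraph V) {M : ℝ} (hM : ∀ i, ((G.nbhd i).card : ℝ) ≤ M)
    {F : V → ℝ} (hF : ∀ i, 0 ≤ F i) : ∑ i, ∑ _j ∈ G.nbhd i, F i ≤ M * ∑ i, F i := by
  rw [Finset.mul_sum]
  refine Finset.sum_le_sum fun j _ => ?_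
  rw [Finset.sum_const, nsmul_eq_mul]
  exact mul_le_mul_of_nonneg_right (hM j) (hF j)

/-- The pairs of vertices that are equal or adjacent. -/
noncomputable def Multigraph.pairs (G : Multigraph V) : Finset (Σ _ : V, V) :=
  Finset.univ.sigma G.nbhd

/-- Two pairs of vertices are related if they are equal or adjacent through one vertex of each. -/
def Multigraph.PairRel (G : Multigraph V) (p q : Σ _ : V, V) : Prop :=
  (q.1 ∈ G.nbhd p.1 ∨ q.1 ∈ G.nbhd p.2) ∨ (q.2 ∈ G.nbhd p.1 ∨ q.2 ∈ G.nbhd p.2)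

lemma Multigraph.PairRel.symm {G : Multigraph V} {p q : Σ _ : V, V} (h : G.PairRel p q) :
    G.PairRel q p := by
  unfold Multigraph.PairRel at *
  rw [Multigraph.mem_nbhd_comm (i := q.1), Multigraph.mem_nbhd_comm (i := q.2),
    Multigraph.mem_nbhd_comm (i := q.1), Multigraph.mem_nbhd_comm (i := q.2)]
  tauto

open Classical in
-- A related pair has one of its two entries in the neighbourhood of one of the two entries of `p`:
-- four cases, each leaving at most `m` choices for that entry and `m` for its partner.
lemma Multigraph.card_pairs_filter_le (G : Multigraph V) {m : ℕ} (hm : ∀ i, (G.nbhd i).card ≤ m)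
    (p : Σ _ : V, V) : (G.pairs.filter (G.PairRel p)).card ≤ 4 * m ^ 2 := by
  have hfst : ∀ a, (G.pairs.filter fun q => q.1 ∈ G.nbhd a).card ≤ m ^ 2 := by
    intro a
    have : (G.pairs.filter fun q => q.1 ∈ G.nbhd a) ⊆
        (G.nbhd a).biUnion fun k => (G.nbhd k).image fun l => ⟨k, l⟩ := by
      rintro ⟨k, l⟩ hq
      simp only [Multigraph.pairs, Finset.mem_filter, Finset.mem_sigma, Finset.mem_univ,
        true_and] at hq
      simp only [Finset.mem_biUnion, Finset.mem_image]
      exact ⟨k, hq.2, l, hq.1, rfl⟩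
    refine (Finset.card_le_card this).trans ((Finset.card_biUnion_le_card_mul _ _ m
      fun k _ => Finset.card_image_le.trans (hm k)).trans ?_)
    nlinarith [hm a]
  have hsnd : ∀ a, (G.pairs.filter fun q => q.2 ∈ G.nbhd a).card ≤ m ^ 2 := by
    intro a
    have : (G.pairs.filter fun q => q.2 ∈ G.nbhd a) ⊆
        (G.nbhd a).biUnion fun l => (G.nbhd l).image fun k => ⟨k, l⟩ := by
      rintro ⟨k, l⟩ hq
      simp only [Multigraph.pairs, Finset.mem_filter, Finset.mem_sigma, Finset.mem_univ,
        true_and] at hq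
      simp only [Finset.mem_biUnion, Finset.mem_image]
      exact ⟨l, hq.2, k, Multigraph.mem_nbhd_comm.1 hq.1, rfl⟩
    refine (Finset.card_le_card this).trans ((Finset.card_biUnion_le_card_mul _ _ m
      fun k _ => Finset.card_image_le.trans (hm k)).trans ?_)
    nlinarith [hm a]
  have e : G.pairs.filter (G.PairRel p)
      = (G.pairs.filter (fun q => q.1 ∈ G.nbhd p.1) ∪ G.pairs.filter (fun q => q.1 ∈ G.nbhd p.2)) ∪
        (G.pairs.filter (fun q => q.2 ∈ G.nbhd p.1) ∪ G.pairs.filter fun q => q.2 ∈ G.nbhd p.2) := by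
    ext q
    simp only [Multigraph.PairRel, Finset.mem_filter, Finset.mem_union]
    tauto
  rw [e]
  refine (Finset.card_union_le _ _).trans ?_
  have h1 := Finset.card_union_le (G.pairs.filter fun q => q.1 ∈ G.nbhd p.1)
    (G.pairs.filter fun q => q.1 ∈ G.nbhd p.2)
  have h2 := Finset.card_union_le (G.pairs.filter fun q => q.2 ∈ G.nbhd p.1)
    (G.pairs.filter fun q => q.2 ∈ G.nbhd p.2)
  have := hfst p.1
  have := hfst p.2
  have := hsnd p.1
  have := hsnd p.2
  omega

variable {P : Measure Ω}

lemma IsDependencyGraph.indepFun_comp {G : Multigraph V} {Y : V → Ω → ℝ}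
    (hG : IsDependencyGraph G Y P) {V₁ V₂ : Finset V} (h : ∀ i ∈ V₁, ∀ j ∈ V₂, j ∉ G.nbhd i)
    {φ : (V₁ → ℝ) → ℝ} {ψ : (V₂ → ℝ) → ℝ} (hφ : Measurable φ) (hψ : Measurable ψ) :
    IndepFun (fun ω => φ fun k => Y k ω) (fun ω => ψ fun k => Y k ω) P := by
  refine (hG V₁ V₂ ?_ fun i hi j hj he => h i hi j hj (Multigraph.mem_nbhd.2 (Or.inr he))).comp hφ hψ
  rw [Finset.disjoint_left]
  exact fun i hi hi' => h i hi i hi' (G.self_mem_nbhd i)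

lemma IsDependencyGraph.indepFun {G : Multigraph V} {Y : V → Ω → ℝ}
    (hG : IsDependencyGraph G Y P) {i j : V} (h : j ∉ G.nbhd i) : IndepFun (Y i) (Y j) P := by
  refine hG.indepFun_comp (V₁ := {i}) (V₂ := {j}) (by simpa using h)
    (φ := fun x => x ⟨i, by simp⟩) (ψ := fun x => x ⟨j, by simp⟩) ?_ ?_ <;>
  exact measurable_pi_apply _

lemma IsDependencyGraph.indepFun_mul {G : Multigraph V} {Y : V → Ω → ℝ}
    (hG : IsDependencyGraph G Y P) {p q : Σ _ : V, V} (h : ¬ G.PairRel p q) :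
    IndepFun (fun ω => Y p.1 ω * Y p.2 ω) (fun ω => Y q.1 ω * Y q.2 ω) P := by
  classical
  have h' : ∀ i ∈ ({p.1, p.2} : Finset V), ∀ j ∈ ({q.1, q.2} : Finset V), j ∉ G.nbhd i := by
    intro i hi j hj hij
    rw [Finset.mem_insert, Finset.mem_singleton] at hi hj
    apply h
    unfold Multigraph.PairRel
    rcases hi with rfl | rfl <;> rcases hj with rfl | rfl <;> tauto
  refine hG.indepFun_comp h' (φ := fun x => x ⟨p.1, by simp⟩ * x ⟨p.2, by simp⟩)
    (ψ := fun x => x ⟨q.1, by simp⟩ * x ⟨q.2, by simp⟩) ?_ ?_ <;>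
  exact (measurable_pi_apply _).mul (measurable_pi_apply _)

/-- The key independence of Stein's method: removing the closed neighbourhood of `i` leaves only
variables without an edge to `i`. -/
lemma IsDependencyGraph.indepFun_sub {G : Multigraph V} {Y : V → Ω → ℝ}
    (hG : IsDependencyGraph G Y P) (i : V) :
    IndepFun (Y i) (fun ω => ∑ j, Y j ω - ∑ j ∈ G.nbhd i, Y j ω) P := by
  classical
  have e : (fun ω => ∑ j, Y j ω - ∑ j ∈ G.nbhd i, Y j ω)
      = fun ω => ∑ j : ((G.nbhd i)ᶜ : Finset V), Y j ω := by
    ext ω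
    rw [Finset.sum_coe_sort (G.nbhd i)ᶜ fun j => Y j ω, sub_eq_iff_eq_add',
      Finset.sum_add_sum_compl]
  rw [e]
  refine hG.indepFun_comp (V₁ := {i}) (V₂ := (G.nbhd i)ᶜ) (by simp)
    (φ := fun x => x ⟨i, by simp⟩) (ψ := fun x => ∑ j, x j) (measurable_pi_apply _) ?_
  exact Finset.measurable_sum _ fun j _ => measurable_pi_apply j

end

/-! ### Variance of sums with few nonzero covariances -/

section

variable {Ω ι : Type*} [MeasurableSpace Ω] {P : Measure Ω} [IsProbabilityMeasure P]

lemma covariance_le_half_add {X Y : Ω → ℝ} (hX : MemLp X 2 P) (hY : MemLp Y 2 P) :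
    cov[X, Y; P] ≤ (Var[X; P] + Var[Y; P]) / 2 := by
  have h := variance_sub hX hY
  have h0 := variance_nonneg (X - Y) P
  linarith

open Classical in
/-- The variance of a sum of variables for which few covariances do not vanish. -/
lemma variance_sum_le_of_covariance_eq_zero {U : ι → Ω → ℝ} {s : Finset ι}
    (hU : ∀ p ∈ s, MemLp (U p) 2 P) {R : ι → ι → Prop} (hR : ∀ p q, R p q → R q p) {K : ℝ}
    (hK : ∀ p ∈ s, ((s.filter (R p)).card : ℝ) ≤ K)
    (h0 : ∀ p ∈ s, ∀ q ∈ s, ¬ R p q → cov[U p, U q; P] = 0) :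
    Var[fun ω => ∑ p ∈ s, U p ω; P] ≤ K * ∑ p ∈ s, Var[U p; P] := by
  rw [variance_fun_sum' hU]
  have hv : ∀ p, 0 ≤ Var[U p; P] := fun p => variance_nonneg _ _
  calc ∑ p ∈ s, ∑ q ∈ s, cov[U p, U q; P]
      ≤ ∑ p ∈ s, ∑ q ∈ s, if R p q then (Var[U p; P] + Var[U q; P]) / 2 else 0 := by
        refine Finset.sum_le_sum fun p hp => Finset.sum_le_sum fun q hq => ?_
        split_ifs with h
        · exact covariance_le_half_add (hU p hp) (hU q hq)
        · exact (h0 p hp q hq h).le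
    _ = ∑ p ∈ s, ∑ q ∈ s, (if R p q then Var[U p; P] else 0) := by
        -- By the symmetry of `R`, the half carried by `q` can be moved to `p` after exchanging the
        -- sums.
        have e : ∀ p q, (if R p q then (Var[U p; P] + Var[U q; P]) / 2 else 0)
            = (if R p q then Var[U p; P] else 0) / 2 + (if R q p then Var[U q; P] else 0) / 2 := by
          intro p q
          by_cases h : R p q
          · rw [if_pos h, if_pos h, if_pos (hR _ _ h)]; ring
          · rw [if_neg h, if_neg h, if_neg fun h' => h (hR _ _ h')]; ring
        simp_rw [e, Finset.sum_add_distrib]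
        rw [Finset.sum_comm (f := fun p q => (if R q p then Var[U q; P] else 0) / 2)]
        simp_rw [← Finset.sum_add_distrib, add_halves]
    _ ≤ K * ∑ p ∈ s, Var[U p; P] := by
        rw [Finset.mul_sum]
        refine Finset.sum_le_sum fun p hp => ?_
        rw [← Finset.sum_filter, Finset.sum_const, nsmul_eq_mul]
        exact mul_le_mul_of_nonneg_right (hK p hp) (hv p)

end

/-! ### Bounded measurable variables and concentration on intervals -/

section

variable {Ω : Type*} [MeasurableSpace Ω]

/-- Bounded measurable real functions. -/
def BddMeasurable (f : Ω → ℝ) : Prop := Measurable f ∧ ∃ C, ∀ ω, |f ω| ≤ C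

namespace BddMeasurable

variable {f g : Ω → ℝ}

lemma const (c : ℝ) : BddMeasurable fun _ : Ω => c := ⟨measurable_const, |c|, fun _ => le_rfl⟩

lemma add (hf : BddMeasurable f) (hg : BddMeasurable g) : BddMeasurable fun ω => f ω + g ω := by
  obtain ⟨hf, C, hC⟩ := hf
  obtain ⟨hg, D, hD⟩ := hg
  exact ⟨hf.add hg, C + D, fun ω => (abs_add_le _ _).trans (add_le_add (hC ω) (hD ω))⟩

lemma sub (hf : BddMeasurable f) (hg : BddMeasurable g) : BddMeasurable fun ω => f ω - g ω := by
  obtain ⟨hf, C, hC⟩ := hf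
  obtain ⟨hg, D, hD⟩ := hg
  exact ⟨hf.sub hg, C + D, fun ω => (abs_sub _ _).trans (add_le_add (hC ω) (hD ω))⟩

lemma mul (hf : BddMeasurable f) (hg : BddMeasurable g) : BddMeasurable fun ω => f ω * g ω := by
  obtain ⟨hf, C, hC⟩ := hf
  obtain ⟨hg, D, hD⟩ := hg
  refine ⟨hf.mul hg, C * D, fun ω => ?_⟩
  rw [abs_mul]
  exact mul_le_mul (hC ω) (hD ω) (abs_nonneg _) ((abs_nonneg _).trans (hC ω))

lemma sum {ι : Type*} {s : Finset ι} {f : ι → Ω → ℝ} (hf : ∀ i, BddMeasurable (f i)) :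
    BddMeasurable fun ω => ∑ i ∈ s, f i ω := by
  choose h C hC using hf
  refine ⟨Finset.measurable_sum _ fun i _ => h i, ∑ i ∈ s, C i, fun ω => ?_⟩
  exact (Finset.abs_sum_le_sum_abs _ _).trans (Finset.sum_le_sum fun i _ => hC i ω)

lemma comp (hf : BddMeasurable f) {φ : ℝ → ℝ} (hφ : Continuous φ) :
    BddMeasurable fun ω => φ (f ω) := by
  obtain ⟨hf, C, hC⟩ := hf
  obtain ⟨D, hD⟩ := (isCompact_Icc (a := -C) (b := C)).exists_bound_of_continuousOn hφ.continuousOn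
  exact ⟨hφ.measurable.comp hf, D, fun ω => hD _ (abs_le.1 (hC ω))⟩

lemma abs (hf : BddMeasurable f) : BddMeasurable fun ω => |f ω| := hf.comp continuous_abs

lemma pow (hf : BddMeasurable f) (n : ℕ) : BddMeasurable fun ω => f ω ^ n :=
  hf.comp (continuous_pow n)

lemma indicator_comp (hf : Measurable f) {s : Set ℝ} (hs : MeasurableSet s) :
    BddMeasurable fun ω => s.indicator (1 : ℝ → ℝ) (f ω) := by
  refine ⟨(measurable_one.indicator hs).comp hf, 1, fun ω => ?_⟩
  by_cases h : f ω ∈ s <;> simp [h]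

variable {P : Measure Ω} [IsProbabilityMeasure P]

lemma memLp (hf : BddMeasurable f) (p : ENNReal) : MemLp f p P := by
  obtain ⟨hf, C, hC⟩ := hf
  exact MemLp.of_bound hf.aestronglyMeasurable C (Filter.Eventually.of_forall hC)

lemma integrable (hf : BddMeasurable f) : Integrable f P := memLp_one_iff_integrable.1 (hf.memLp 1)

end BddMeasurable

variable {P : Measure Ω} [IsProbabilityMeasure P]

lemma integral_abs_le_sqrt_integral_sq {U : Ω → ℝ} (hU : MemLp U 2 P) :
    ∫ ω, |U ω| ∂P ≤ √(∫ ω, U ω ^ 2 ∂P) := by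
  apply Real.le_sqrt_of_sq_le
  have h := variance_eq_sub hU.abs
  have h0 := variance_nonneg |U| P
  have e : ∫ ω, (|U| ^ 2) ω ∂P = ∫ ω, U ω ^ 2 ∂P := by simp
  rw [e] at h
  have e2 : ∫ ω, |U| ω ∂P = ∫ ω, |U ω| ∂P := rfl
  rw [e2] at h
  linarith

/-- The concentration estimate through which the unknown distance `Δ` enters its own bound. -/
lemma integral_indicator_Icc_comp_le {W : Ω → ℝ} (hW : Measurable W) {Δ : ℝ}
    (hΔ : ∀ t, |P.real {ω | W ω ≤ t} - (gaussianReal 0 1).real (Set.Iic t)| ≤ Δ) {l u : ℝ}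
    (hlu : l ≤ u) :
    ∫ ω, (Set.Icc l u).indicator (1 : ℝ → ℝ) (W ω) ∂P ≤ 0.4 * (u - l) + 2 * Δ := by
  have e : (fun ω => (Set.Icc l u).indicator (1 : ℝ → ℝ) (W ω))
      = (W ⁻¹' Set.Icc l u).indicator 1 := rfl
  rw [e, integral_indicator_one (hW measurableSet_Icc)]
  -- The slack `ε` accounts for a possible atom of `W` at `l`.
  refine le_of_forall_pos_le_add fun ε hε => ?_
  have hsub : P.real (W ⁻¹' Set.Icc l u) + P.real {ω | W ω ≤ l - ε} ≤ P.real {ω | W ω ≤ u} := by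
    have hms : MeasurableSet {ω | W ω ≤ l - ε} := hW measurableSet_Iic
    rw [← measureReal_union (μ := P) (s₁ := W ⁻¹' Set.Icc l u) ?_ hms]
    · refine measureReal_mono fun ω hω => ?_
      rcases hω with h | h
      · exact h.2
      · have : W ω ≤ l - ε := h
        show W ω ≤ u
        linarith
    · rw [Set.disjoint_left]
      intro ω h h'
      have h1 : l ≤ W ω := h.1
      have h2 : W ω ≤ l - ε := h'
      linarith
  have h1 := abs_le.1 (hΔ u)
  have h2 := abs_le.1 (hΔ (l - ε))
  have h3 := gaussianReal_real_Iic_le (a := l - ε) (b := u) (by linarith)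
  linarith [h1.2, h2.1]

end

/-! ### The local quadratic form -/

section

variable {V : Type*} [Fintype V]

/-- The sum of the third order products along edges is controlled by the third powers. -/
lemma Multigraph.sum_abs_mul_sq_sum_nbhd_le (G : Multigraph V) {M : ℝ}
    (hM : ∀ i, ((G.nbhd i).card : ℝ) ≤ M) (hM0 : 0 ≤ M) (x : V → ℝ) :
    ∑ i, |x i| * (∑ j ∈ G.nbhd i, x j) ^ 2 ≤ M ^ 2 * ∑ i, |x i| ^ 3 := by
  have hpt : ∀ a b : ℝ, |a| * b ^ 2 ≤ 1 / 3 * |a| ^ 3 + 2 / 3 * |b| ^ 3 := by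
    intro a b
    rw [← sq_abs b]
    -- For nonnegative `a`, `b`: `a³ - 3 a b² + 2 b³ = (a + 2b) (a - b)²`.
    nlinarith [mul_nonneg (add_nonneg (abs_nonneg a) (mul_nonneg zero_le_two (abs_nonneg b)))
      (sq_nonneg (|a| - |b|))]
  calc ∑ i, |x i| * (∑ j ∈ G.nbhd i, x j) ^ 2
      ≤ ∑ i, M * ∑ j ∈ G.nbhd i, (1 / 3 * |x i| ^ 3 + 2 / 3 * |x j| ^ 3) := by
        refine Finset.sum_le_sum fun i _ => ?_
        calc |x i| * (∑ j ∈ G.nbhd i, x j) ^ 2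
            ≤ |x i| * (M * ∑ j ∈ G.nbhd i, x j ^ 2) := by
              refine mul_le_mul_of_nonneg_left (sq_sum_le_card_mul_sum_sq.trans ?_) (abs_nonneg _)
              exact mul_le_mul_of_nonneg_right (hM i) (Finset.sum_nonneg fun _ _ => sq_nonneg _)
          _ = M * ∑ j ∈ G.nbhd i, |x i| * x j ^ 2 := by
              rw [Finset.mul_sum, Finset.mul_sum, Finset.mul_sum]
              refine Finset.sum_congr rfl fun j _ => ?_
              ring
          _ ≤ _ := mul_le_mul_of_nonneg_left (Finset.sum_le_sum fun j _ => hpt _ _) hM0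
    _ = M * (∑ i, ∑ _j ∈ G.nbhd i, 1 / 3 * |x i| ^ 3
          + ∑ i, ∑ j ∈ G.nbhd i, 2 / 3 * |x j| ^ 3) := by
        rw [← Finset.mul_sum, ← Finset.sum_add_distrib]
        congr 1
        exact Finset.sum_congr rfl fun i _ => Finset.sum_add_distrib
    _ ≤ M * (M * ∑ i, 1 / 3 * |x i| ^ 3 + M * ∑ i, 2 / 3 * |x i| ^ 3) := by
        refine mul_le_mul_of_nonneg_left (add_le_add ?_ ?_) hM0
        · exact G.sum_sum_nbhd_le' (F := fun i => 1 / 3 * |x i| ^ 3) hM fun i => by positivity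
        · exact G.sum_sum_nbhd_le (F := fun i => 2 / 3 * |x i| ^ 3) hM fun i => by positivity
    _ = M ^ 2 * ∑ i, |x i| ^ 3 := by
        rw [← Finset.mul_sum, ← Finset.mul_sum]
        ring

variable {Ω : Type*} [MeasurableSpace Ω] {P : Measure Ω} [IsProbabilityMeasure P]

/-- The form is a sum over pairs, each uncorrelated with all but `4 m²` others. Each variance is at
most a mean of two fourth moments, and `X⁴ ≤ B |X|³` reduces these to third moments. -/
lemma variance_sum_mul_sum_nbhd_le {G : Multigraph V} {X : V → Ω → ℝ}
    (hX : ∀ i, Measurable (X i)) (hG : IsDependencyGraph G X P) {m : ℕ}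
    (hm : ∀ i, (G.nbhd i).card ≤ m) {B : ℝ} (hB : ∀ i ω, |X i ω| ≤ B) :
    Var[fun ω => ∑ i, X i ω * ∑ j ∈ G.nbhd i, X j ω; P]
      ≤ 4 * (m * B) * (m ^ 2 * ∑ i, ∫ ω, |X i ω| ^ 3 ∂P) := by
  classical
  have hb : ∀ i, BddMeasurable (X i) := fun i => ⟨hX i, B, hB i⟩
  have hM : ∀ i, ((G.nbhd i).card : ℝ) ≤ m := fun i => Nat.cast_le.2 (hm i)
  have e : (fun ω => ∑ i, X i ω * ∑ j ∈ G.nbhd i, X j ω)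
      = fun ω => ∑ p ∈ G.pairs, X p.1 ω * X p.2 ω := by
    ext ω
    simp [Multigraph.pairs, Finset.sum_sigma, Finset.mul_sum]
  have hU : ∀ p : Σ _ : V, V, MemLp (fun ω => X p.1 ω * X p.2 ω) 2 P :=
    fun p => ((hb _).mul (hb _)).memLp 2
  set F : V → ℝ := fun i => 1 / 2 * (B * ∫ ω, |X i ω| ^ 3 ∂P) with hF
  have hF0 : ∀ i, 0 ≤ F i := by
    intro i
    have : Nonempty Ω := nonempty_of_isProbabilityMeasure P
    have hB0 : 0 ≤ B := (abs_nonneg _).trans (hB i (Classical.arbitrary Ω))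
    have : 0 ≤ ∫ ω, |X i ω| ^ 3 ∂P := integral_nonneg fun ω => by positivity
    rw [hF]
    positivity
  have hvar : ∀ p : Σ _ : V, V, Var[fun ω => X p.1 ω * X p.2 ω; P] ≤ F p.1 + F p.2 := by
    intro p
    refine (variance_le_expectation_sq ((hb _).mul (hb _)).1.aestronglyMeasurable).trans ?_
    have hi : ∀ i, Integrable (fun ω => B * |X i ω| ^ 3) P :=
      fun i => (((hb i).abs.pow 3).integrable).const_mul B
    calc ∫ ω, ((fun ω => X p.1 ω * X p.2 ω) ^ 2) ω ∂P
        ≤ ∫ ω, (1 / 2 * (B * |X p.1 ω| ^ 3) + 1 / 2 * (B * |X p.2 ω| ^ 3)) ∂P := by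
          refine integral_mono (((hb _).mul (hb _)).pow 2).integrable
            (((hi _).const_mul _).add ((hi _).const_mul _)) fun ω => ?_
          have h4 : ∀ i, X i ω ^ 4 ≤ B * |X i ω| ^ 3 := by
            intro i
            have : X i ω ^ 4 = |X i ω| * |X i ω| ^ 3 := by
              rw [← pow_succ', (by decide : Even 4).pow_abs]
            rw [this]
            exact mul_le_mul_of_nonneg_right (hB i ω) (by positivity)
          have h1 := h4 p.1
          have h2 := h4 p.2
          simp only [Pi.pow_apply]
          nlinarith [sq_nonneg (X p.1 ω ^ 2 - X p.2 ω ^ 2)]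
      _ = F p.1 + F p.2 := by
          rw [integral_add ((hi _).const_mul _) ((hi _).const_mul _)]
          simp only [integral_const_mul, hF]
  have hcard : ∀ p ∈ G.pairs, ((G.pairs.filter (G.PairRel p)).card : ℝ) ≤ 4 * (m : ℝ) ^ 2 :=
    fun p _ => by exact_mod_cast G.card_pairs_filter_le hm p
  have hcov : ∀ p ∈ G.pairs, ∀ q ∈ G.pairs, ¬ G.PairRel p q →
      cov[fun ω => X p.1 ω * X p.2 ω, fun ω => X q.1 ω * X q.2 ω; P] = 0 :=
    fun p _ q _ h => (hG.indepFun_mul h).covariance_eq_zero (hU p) (hU q)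
  have key := variance_sum_le_of_covariance_eq_zero (fun p _ => hU p)
    (fun p q h => Multigraph.PairRel.symm h) hcard hcov
  rw [e]
  calc _ ≤ (4 * (m : ℝ) ^ 2) * ∑ p ∈ G.pairs, Var[fun ω => X p.1 ω * X p.2 ω; P] := key
    _ ≤ (4 * (m : ℝ) ^ 2) * ∑ p ∈ G.pairs, (F p.1 + F p.2) := by
        gcongr with p _
        exact hvar p
    _ = (4 * (m : ℝ) ^ 2) * (∑ i, ∑ _j ∈ G.nbhd i, F i + ∑ i, ∑ j ∈ G.nbhd i, F j) := by
        rw [Multigraph.pairs, Finset.sum_sigma, ← Finset.sum_add_distrib]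
        congr 1
        exact Finset.sum_congr rfl fun i _ => Finset.sum_add_distrib
    _ ≤ (4 * (m : ℝ) ^ 2) * (m * ∑ i, F i + m * ∑ i, F i) := by
        gcongr
        · exact G.sum_sum_nbhd_le' hM hF0
        · exact G.sum_sum_nbhd_le hM hF0
    _ = _ := by
        simp only [hF, ← Finset.mul_sum]
        ring

end

/-! ### Stein's method for bounded variables -/

section

variable {V Ω : Type*} [Fintype V] [MeasurableSpace Ω]
variable {P : Measure Ω} {G : Multigraph V} {X : V → Ω → ℝ}

lemma IsDependencyGraph.integral_mul_comp_sub_eq_zero (hX : ∀ i, BddMeasurable (X i))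
    (hG : IsDependencyGraph G X P) (h0 : ∀ i, ∫ ω, X i ω ∂P = 0) {f : ℝ → ℝ} (hf : Continuous f)
    (i : V) : ∫ ω, X i ω * f (∑ j, X j ω - ∑ j ∈ G.nbhd i, X j ω) ∂P = 0 := by
  have hW : BddMeasurable fun ω => ∑ j, X j ω - ∑ j ∈ G.nbhd i, X j ω :=
    (BddMeasurable.sum hX).sub (BddMeasurable.sum hX)
  have h := (hG.indepFun_sub i).integral_fun_comp_mul_comp (f := id) (g := f)
    (hX i).1.aemeasurable hW.1.aemeasurable measurable_id.aestronglyMeasurable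
    hf.measurable.aestronglyMeasurable
  simp only [id] at h
  rw [h, h0, zero_mul]

variable [IsProbabilityMeasure P]

lemma IsDependencyGraph.integral_sum_mul_sum_nbhd (hX : ∀ i, BddMeasurable (X i))
    (hG : IsDependencyGraph G X P) (h0 : ∀ i, ∫ ω, X i ω ∂P = 0) :
    ∫ ω, ∑ i, X i ω * ∑ j ∈ G.nbhd i, X j ω ∂P = ∫ ω, (∑ i, X i ω) ^ 2 ∂P := by
  have hW : BddMeasurable fun ω => ∑ j, X j ω := BddMeasurable.sum hX
  have hη : ∀ i, BddMeasurable fun ω => ∑ j ∈ G.nbhd i, X j ω := fun i => BddMeasurable.sum hX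
  have e : (fun ω => (∑ i, X i ω) ^ 2) = fun ω => (∑ i, X i ω * ∑ j ∈ G.nbhd i, X j ω) +
      ∑ i, X i ω * (∑ j, X j ω - ∑ j ∈ G.nbhd i, X j ω) := by
    ext ω
    simp_rw [mul_sub, Finset.sum_sub_distrib, ← Finset.sum_mul]
    ring
  rw [e, integral_add (BddMeasurable.sum fun i => (hX i).mul (hη i)).integrable
    (BddMeasurable.sum fun i => (hX i).mul (hW.sub (hη i))).integrable,
    integral_finsetSum _ fun i _ => ((hX i).mul (hW.sub (hη i))).integrable]
  have hz : ∀ i, ∫ ω, X i ω * (∑ j, X j ω - ∑ j ∈ G.nbhd i, X j ω) ∂P = 0 :=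
    fun i => hG.integral_mul_comp_sub_eq_zero hX h0 continuous_id i
  simp only [hz, Finset.sum_const_zero, add_zero]

/-- The weight which bounds the increments of the derivative of the Stein solution of a ramp. -/
noncomputable def steinWeight (z α κ β w : ℝ) : ℝ :=
  κ + 2 * |w| + 1 / α * (Set.Icc (z - β) (z + α + β)).indicator 1 w

lemma steinWeight_nonneg {z α κ β : ℝ} (hα : 0 < α) (hκ : 0 ≤ κ) (w : ℝ) :
    0 ≤ steinWeight z α κ β w := by
  have : 0 ≤ (Set.Icc (z - β) (z + α + β)).indicator (1 : ℝ → ℝ) w :=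
    Set.indicator_nonneg (fun _ _ => zero_le_one) _
  unfold steinWeight
  positivity

/-- Allows the argument of the weight to be moved by `b` at the price of larger parameters, so that
`W` and `W - η i` can be exchanged. -/
lemma steinWeight_le {z α κ β b w u : ℝ} (hα : 0 < α) (h : |w - u| ≤ b) :
    steinWeight z α κ β w ≤ steinWeight z α (κ + 2 * b) (β + b) u := by
  unfold steinWeight
  have h1 : |w| ≤ |u| + b := by
    have := abs_add_le u (w - u)
    rw [add_sub_cancel] at this
    linarith
  have h2 : (Set.Icc (z - β) (z + α + β)).indicator (1 : ℝ → ℝ) w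
      ≤ (Set.Icc (z - (β + b)) (z + α + (β + b))).indicator 1 u := by
    obtain ⟨h3, h4⟩ := abs_le.1 h
    by_cases hw : w ∈ Set.Icc (z - β) (z + α + β)
    · have hu : u ∈ Set.Icc (z - (β + b)) (z + α + (β + b)) :=
        ⟨by linarith [hw.1], by linarith [hw.2]⟩
      rw [Set.indicator_of_mem hw, Set.indicator_of_mem hu]
      exact le_rfl
    · rw [Set.indicator_of_notMem hw]
      exact Set.indicator_nonneg (fun _ _ => zero_le_one) _
  have h3 := mul_le_mul_of_nonneg_left h2 (by positivity : 0 ≤ 1 / α)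
  linarith

lemma measurable_steinWeight (z α κ β : ℝ) : Measurable (steinWeight z α κ β) := by
  unfold steinWeight
  exact (measurable_const.add (measurable_const.mul measurable_id.abs)).add
    (measurable_const.mul (measurable_one.indicator measurableSet_Icc))

lemma BddMeasurable.steinWeight {W : Ω → ℝ} (hW : BddMeasurable W) (z α κ β : ℝ) :
    BddMeasurable fun ω => steinWeight z α κ β (W ω) :=
  ((BddMeasurable.const κ).add ((BddMeasurable.const 2).mul hW.abs)).add
    ((BddMeasurable.const (1 / α)).mul (BddMeasurable.indicator_comp hW.1 measurableSet_Icc))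

lemma abs_sum_nbhd_le {m : ℕ} (hm : ∀ i, (G.nbhd i).card ≤ m) {B : ℝ} (hB0 : 0 ≤ B) {x : V → ℝ}
    (hB : ∀ i, |x i| ≤ B) (i : V) : |∑ j ∈ G.nbhd i, x j| ≤ m * B := by
  refine (Finset.abs_sum_le_sum_abs _ _).trans ((Finset.sum_le_sum fun j _ => hB j).trans ?_)
  rw [Finset.sum_const, nsmul_eq_mul]
  exact mul_le_mul_of_nonneg_right (Nat.cast_le.2 (hm i)) hB0

/-- With `b = m * B`, the weight is moved from `W` to `W - η i`, where it is independent of `X i`,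
and after factoring moved back. The two moves add `4 b` to `κ` and widen the window margin from `b`
to `3 b`, whence the length `α + 6 b`. -/
lemma IsDependencyGraph.integral_abs_pow_mul_steinWeight_le (hX : ∀ i, Measurable (X i))
    (hG : IsDependencyGraph G X P) {m : ℕ} (hm : ∀ i, (G.nbhd i).card ≤ m) {B : ℝ} (hB0 : 0 ≤ B)
    (hB : ∀ i ω, |X i ω| ≤ B) {α Δ z κ : ℝ} (hα : 0 < α)
    (hΔ : ∀ t, |P.real {ω | ∑ i, X i ω ≤ t} - (gaussianReal 0 1).real (Set.Iic t)| ≤ Δ) (i : V) :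
    ∫ ω, |X i ω| ^ 3 * steinWeight z α κ (m * B) (∑ j, X j ω) ∂P ≤ (∫ ω, |X i ω| ^ 3 ∂P) *
      (κ + 2 * ∫ ω, |∑ j, X j ω| ∂P + 4 * (m * B)
        + 1 / α * (0.4 * (α + 6 * (m * B)) + 2 * Δ)) := by
  have hb : ∀ i, BddMeasurable (X i) := fun i => ⟨hX i, B, hB i⟩
  have hW : BddMeasurable fun ω => ∑ j, X j ω := BddMeasurable.sum hb
  have hη : BddMeasurable fun ω => ∑ j ∈ G.nbhd i, X j ω := BddMeasurable.sum hb
  have hη' : ∀ ω, |∑ j ∈ G.nbhd i, X j ω| ≤ m * B := fun ω => abs_sum_nbhd_le hm hB0 (hB · ω) i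
  have h3 : BddMeasurable fun ω => |X i ω| ^ 3 := (hb i).abs.pow 3
  set b := (m : ℝ) * B with hbdef
  have hb0 : 0 ≤ b := by positivity
  calc ∫ ω, |X i ω| ^ 3 * steinWeight z α κ b (∑ j, X j ω) ∂P
      ≤ ∫ ω, |X i ω| ^ 3 * steinWeight z α (κ + 2 * b) (b + b)
          (∑ j, X j ω - ∑ j ∈ G.nbhd i, X j ω) ∂P := by
        refine integral_mono (h3.mul (hW.steinWeight _ _ _ _)).integrable
          (h3.mul ((hW.sub hη).steinWeight _ _ _ _)).integrable fun ω => ?_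
        refine mul_le_mul_of_nonneg_left (steinWeight_le hα ?_) (by positivity)
        simpa using hη' ω
    _ = (∫ ω, |X i ω| ^ 3 ∂P) * ∫ ω, steinWeight z α (κ + 2 * b) (b + b)
          (∑ j, X j ω - ∑ j ∈ G.nbhd i, X j ω) ∂P :=
        (hG.indepFun_sub i).integral_fun_comp_mul_comp (f := fun x => |x| ^ 3)
          (g := steinWeight z α (κ + 2 * b) (b + b))
          (hX i).aemeasurable (hW.sub hη).1.aemeasurable
          (by fun_prop : Continuous fun x : ℝ => |x| ^ 3).measurable.aestronglyMeasurable
          (measurable_steinWeight _ _ _ _).aestronglyMeasurable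
    _ ≤ _ := by
        refine mul_le_mul_of_nonneg_left ?_ (integral_nonneg fun ω => by positivity)
        calc ∫ ω, steinWeight z α (κ + 2 * b) (b + b)
              (∑ j, X j ω - ∑ j ∈ G.nbhd i, X j ω) ∂P
            ≤ ∫ ω, steinWeight z α (κ + 2 * b + 2 * b) (b + b + b) (∑ j, X j ω) ∂P := by
              refine integral_mono ((hW.sub hη).steinWeight _ _ _ _).integrable
                (hW.steinWeight _ _ _ _).integrable fun ω => steinWeight_le hα ?_
              simpa using hη' ω
          _ = (κ + 2 * b + 2 * b) + 2 * ∫ ω, |∑ j, X j ω| ∂P + 1 / α *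
                ∫ ω, (Set.Icc (z - (b + b + b)) (z + α + (b + b + b))).indicator (1 : ℝ → ℝ)
                  (∑ j, X j ω) ∂P := by
              unfold steinWeight
              have hi := (BddMeasurable.indicator_comp hW.1
                (measurableSet_Icc (a := z - (b + b + b)) (b := z + α + (b + b + b)))).integrable
                (P := P)
              have hA := ((BddMeasurable.const (κ + 2 * b + 2 * b)).add
                ((BddMeasurable.const 2).mul hW.abs)).integrable (P := P)
              rw [integral_add hA (hi.const_mul _),
                integral_add (integrable_const _) (hW.abs.integrable.const_mul _),
                integral_const_mul, integral_const_mul]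
              simp
          _ ≤ _ := by
              have h := integral_indicator_Icc_comp_le hW.1 hΔ
                (l := z - (b + b + b)) (u := z + α + (b + b + b)) (by linarith)
              have h' := mul_le_mul_of_nonneg_left h (by positivity : 0 ≤ 1 / α)
              have e : z + α + (b + b + b) - (z - (b + b + b)) = α + 6 * b := by ring
              rw [e] at h'
              linarith

/-- Stein's method for the sum of bounded centered variables with a dependency graph, tested on a
ramp. -/
theorem IsDependencyGraph.abs_integral_rampDown_sub_le (hX : ∀ i, Measurable (X i))
    (hG : IsDependencyGraph G X P) {m : ℕ} (hm : ∀ i, (G.nbhd i).card ≤ m) {B : ℝ} (hB0 : 0 ≤ B)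
    (hB : ∀ i ω, |X i ω| ≤ B) (h0 : ∀ i, ∫ ω, X i ω ∂P = 0) {α Δ : ℝ} (hα : 0 < α)
    (hΔ : ∀ t, |P.real {ω | ∑ i, X i ω ≤ t} - (gaussianReal 0 1).real (Set.Iic t)| ≤ Δ) (z : ℝ) :
    |∫ ω, rampDown z α (∑ i, X i ω) ∂P - ∫ x, rampDown z α x ∂(gaussianReal 0 1)| ≤
      2 * |1 - ∫ ω, (∑ i, X i ω) ^ 2 ∂P|
        + 4 * √((m * B) * (m ^ 2 * ∑ i, ∫ ω, |X i ω| ^ 3 ∂P))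
        + (m ^ 2 * ∑ i, ∫ ω, |X i ω| ^ 3 ∂P) / 2 *
          (1.26 + 2 * ∫ ω, |∑ j, X j ω| ∂P + 4 * (m * B)
            + 1 / α * (0.4 * (α + 6 * (m * B)) + 2 * Δ)) := by
  have hb : ∀ i, BddMeasurable (X i) := fun i => ⟨hX i, B, hB i⟩
  have hW : BddMeasurable fun ω => ∑ j, X j ω := BddMeasurable.sum hb
  have hη : ∀ i, BddMeasurable fun ω => ∑ j ∈ G.nbhd i, X j ω := fun i => BddMeasurable.sum hb
  have hη' : ∀ i ω, |∑ j ∈ G.nbhd i, X j ω| ≤ m * B :=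
    fun i ω => abs_sum_nbhd_le hm hB0 (hB · ω) i
  have hM : ∀ i, ((G.nbhd i).card : ℝ) ≤ m := fun i => Nat.cast_le.2 (hm i)
  obtain ⟨f, f', hfc, hfc', heq, hfb', htay⟩ :=
    exists_stein_solution_rampDown hα z (m * B)
  set W : Ω → ℝ := fun ω => ∑ j, X j ω with hWdef
  set η : V → Ω → ℝ := fun i ω => ∑ j ∈ G.nbhd i, X j ω with hηdef
  set Q : Ω → ℝ := fun ω => ∑ i, X i ω * η i ω with hQdef
  have hQ : BddMeasurable Q := BddMeasurable.sum fun i => (hb i).mul (hη i)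
  have hEQ : ∫ ω, Q ω ∂P = ∫ ω, W ω ^ 2 ∂P := hG.integral_sum_mul_sum_nbhd hb h0
  have hfW := hW.comp hfc
  have hfW' := hW.comp hfc'
  set x := (m : ℝ) ^ 2 * ∑ i, ∫ ω, |X i ω| ^ 3 ∂P with hx
  -- the remainder of the second order expansion
  have hT2 : |∫ ω, (W ω * f (W ω) - f' (W ω) * Q ω) ∂P| ≤ x / 2 *
      (1.26 + 2 * ∫ ω, |W ω| ∂P + 4 * (m * B) + 1 / α * (0.4 * (α + 6 * (m * B)) + 2 * Δ)) := by
    have hfWη : ∀ i, BddMeasurable fun ω => f (W ω - η i ω) := fun i => (hW.sub (hη i)).comp hfc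
    have hR : ∀ i, BddMeasurable fun ω =>
        X i ω * (f (W ω) - f (W ω - η i ω) - η i ω * f' (W ω)) :=
      fun i => (hb i).mul ((hfW.sub (hfWη i)).sub ((hη i).mul hfW'))
    have e1 : ∫ ω, (W ω * f (W ω) - f' (W ω) * Q ω) ∂P
        = ∫ ω, ∑ i, X i ω * (f (W ω) - f (W ω - η i ω) - η i ω * f' (W ω)) ∂P := by
      -- The last sum has mean zero, since `X i` is centered and independent of `W - η i`.
      have e2 : ∀ ω, W ω * f (W ω) - f' (W ω) * Q ω
          = (∑ i, X i ω * (f (W ω) - f (W ω - η i ω) - η i ω * f' (W ω)))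
            + ∑ i, X i ω * f (W ω - η i ω) := by
        intro ω
        rw [← Finset.sum_add_distrib, hQdef, Finset.mul_sum]
        conv_lhs => rw [hWdef]
        simp only
        rw [Finset.sum_mul, ← Finset.sum_sub_distrib]
        refine Finset.sum_congr rfl fun i _ => ?_
        ring
      simp_rw [e2]
      rw [integral_add (BddMeasurable.sum hR).integrable
        (BddMeasurable.sum fun i => (hb i).mul (hfWη i)).integrable,
        integral_finsetSum (f := fun i ω => X i ω * f (W ω - η i ω)) _
          fun i _ => ((hb i).mul (hfWη i)).integrable,
        Finset.sum_eq_zero (fun i _ => hG.integral_mul_comp_sub_eq_zero hb h0 hfc i), add_zero]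
    rw [e1]
    have hw := hW.steinWeight z α 1.26 (m * B)
    calc _ ≤ ∫ ω, |∑ i, X i ω * (f (W ω) - f (W ω - η i ω) - η i ω * f' (W ω))| ∂P :=
          abs_integral_le_integral_abs
      _ ≤ ∫ ω, (m : ℝ) ^ 2 / 2 * ∑ i, |X i ω| ^ 3 * steinWeight z α 1.26 (m * B) (W ω) ∂P := by
          refine integral_mono (BddMeasurable.sum hR).abs.integrable
            ((BddMeasurable.const _).mul (BddMeasurable.sum fun i =>
              ((hb i).abs.pow 3).mul hw)).integrable fun ω => ?_
          have hw0 : 0 ≤ steinWeight z α 1.26 (m * B) (W ω) :=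
            steinWeight_nonneg hα (by norm_num) _
          calc |∑ i, X i ω * (f (W ω) - f (W ω - η i ω) - η i ω * f' (W ω))|
              ≤ ∑ i, |X i ω| * (η i ω ^ 2 * steinWeight z α 1.26 (m * B) (W ω) / 2) := by
                refine (Finset.abs_sum_le_sum_abs _ _).trans (Finset.sum_le_sum fun i _ => ?_)
                rw [abs_mul]
                exact mul_le_mul_of_nonneg_left (htay _ _ (hη' i ω)) (abs_nonneg _)
            _ = steinWeight z α 1.26 (m * B) (W ω) / 2 * ∑ i, |X i ω| * η i ω ^ 2 := by
                rw [Finset.mul_sum]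
                refine Finset.sum_congr rfl fun i _ => ?_
                ring
            _ ≤ steinWeight z α 1.26 (m * B) (W ω) / 2 * (m ^ 2 * ∑ i, |X i ω| ^ 3) :=
                mul_le_mul_of_nonneg_left
                  (G.sum_abs_mul_sq_sum_nbhd_le hM (Nat.cast_nonneg m) (X · ω)) (by positivity)
            _ = _ := by
                rw [← Finset.sum_mul]
                ring
      _ = (m : ℝ) ^ 2 / 2 * ∑ i, ∫ ω, |X i ω| ^ 3 * steinWeight z α 1.26 (m * B) (W ω) ∂P := by
          rw [integral_const_mul,
            integral_finsetSum _ fun i _ => (((hb i).abs.pow 3).mul hw).integrable]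
      _ ≤ (m : ℝ) ^ 2 / 2 * ∑ i, (∫ ω, |X i ω| ^ 3 ∂P) *
            (1.26 + 2 * ∫ ω, |W ω| ∂P + 4 * (m * B)
              + 1 / α * (0.4 * (α + 6 * (m * B)) + 2 * Δ)) := by
          refine mul_le_mul_of_nonneg_left (Finset.sum_le_sum fun i _ => ?_) (by positivity)
          exact hG.integral_abs_pow_mul_steinWeight_le hX hm hB0 hB hα hΔ i
      _ = _ := by
          rw [← Finset.sum_mul, hx]
          ring
  -- the fluctuation of the quadratic term
  have hT1 : |∫ ω, f' (W ω) * (1 - Q ω) ∂P| ≤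
      2 * |1 - ∫ ω, W ω ^ 2 ∂P| + 4 * √((m * B) * x) := by
    have hQc : BddMeasurable fun ω => Q ω - ∫ ω', Q ω' ∂P := hQ.sub (BddMeasurable.const _)
    have hvar : ∫ ω, |Q ω - ∫ ω', Q ω' ∂P| ∂P ≤ 2 * √((m * B) * x) := by
      refine (integral_abs_le_sqrt_integral_sq (hQc.memLp 2)).trans ?_
      have h := variance_sum_mul_sum_nbhd_le hX hG hm hB
      rw [variance_eq_integral hQ.1.aemeasurable] at h
      calc √(∫ ω, (Q ω - ∫ ω', Q ω' ∂P) ^ 2 ∂P) ≤ √(2 ^ 2 * ((m * B) * x)) :=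
            Real.sqrt_le_sqrt (h.trans (le_of_eq (by ring)))
        _ = 2 * √((m * B) * x) := by
            rw [Real.sqrt_mul (by norm_num), Real.sqrt_sq (by norm_num)]
    calc |∫ ω, f' (W ω) * (1 - Q ω) ∂P| ≤ ∫ ω, |f' (W ω) * (1 - Q ω)| ∂P :=
          abs_integral_le_integral_abs
      _ ≤ ∫ ω, (2 * |1 - ∫ ω', W ω' ^ 2 ∂P| + 2 * |Q ω - ∫ ω', Q ω' ∂P|) ∂P := by
          refine integral_mono (hfW'.mul ((BddMeasurable.const 1).sub hQ)).abs.integrable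
            ((BddMeasurable.const _).add ((BddMeasurable.const 2).mul hQc.abs)).integrable
            fun ω => ?_
          simp only
          rw [abs_mul, ← mul_add, hEQ]
          refine mul_le_mul (hfb' _) ?_ (abs_nonneg _) zero_le_two
          rw [show 1 - Q ω = (1 - ∫ ω', W ω' ^ 2 ∂P) - (Q ω - ∫ ω', W ω' ^ 2 ∂P) by ring]
          exact abs_sub _ _
      _ = 2 * |1 - ∫ ω', W ω' ^ 2 ∂P| + 2 * ∫ ω, |Q ω - ∫ ω', Q ω' ∂P| ∂P := by
          rw [integral_add (integrable_const _) (hQc.abs.integrable.const_mul 2),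
            integral_const_mul 2 fun ω => |Q ω - ∫ ω', Q ω' ∂P|]
          simp
      _ ≤ _ := by linarith
  -- Stein's equation at `W`, with `f' Q` added and subtracted.
  have hmain : ∫ ω, rampDown z α (W ω) ∂P - ∫ x, rampDown z α x ∂(gaussianReal 0 1)
      = ∫ ω, f' (W ω) * (1 - Q ω) ∂P - ∫ ω, (W ω * f (W ω) - f' (W ω) * Q ω) ∂P := by
    rw [← integral_sub (hfW'.mul ((BddMeasurable.const 1).sub hQ)).integrable
      ((hW.mul hfW).sub (hfW'.mul hQ)).integrable]
    have hr := (hW.comp (continuous_rampDown z α)).integrable (P := P)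
    generalize ∫ x, rampDown z α x ∂(gaussianReal 0 1) = c at heq ⊢
    have hc : ∫ _ω : Ω, c ∂P = c := by simp
    rw [← hc, ← integral_sub hr (integrable_const _)]
    congr 1
    ext ω
    rw [← heq]
    ring
  rw [hmain]
  exact (abs_sub _ _).trans (add_le_add hT1 hT2)

end

/-! ### Kolmogorov distance: smoothing and perturbation -/

lemma bddAbove_range_abs_measureReal_Iic_sub (μ ν : Measure ℝ) [IsProbabilityMeasure μ]
    [IsProbabilityMeasure ν] :
    BddAbove (Set.range fun t : ℝ => |μ.real (Set.Iic t) - ν.real (Set.Iic t)|) := by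
  refine ⟨1, ?_⟩
  rintro _ ⟨t, rfl⟩
  have h1 : μ.real (Set.Iic t) ≤ 1 := measureReal_le_one
  have h2 : ν.real (Set.Iic t) ≤ 1 := measureReal_le_one
  have h3 : 0 ≤ μ.real (Set.Iic t) := measureReal_nonneg
  have h4 : 0 ≤ ν.real (Set.Iic t) := measureReal_nonneg
  rw [abs_le]
  constructor <;> linarith

lemma abs_measureReal_Iic_sub_le_kolmogorovDist (μ ν : Measure ℝ) [IsProbabilityMeasure μ]
    [IsProbabilityMeasure ν] (t : ℝ) :
    |μ.real (Set.Iic t) - ν.real (Set.Iic t)| ≤ kolmogorovDist μ ν :=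
  le_ciSup (bddAbove_range_abs_measureReal_Iic_sub μ ν) t

lemma kolmogorovDist_nonneg (μ ν : Measure ℝ) : 0 ≤ kolmogorovDist μ ν :=
  Real.iSup_nonneg fun _ => abs_nonneg _

lemma kolmogorovDist_le_one (μ ν : Measure ℝ) [IsProbabilityMeasure μ]
    [IsProbabilityMeasure ν] : kolmogorovDist μ ν ≤ 1 := by
  refine ciSup_le fun t => ?_
  have h1 : μ.real (Set.Iic t) ≤ 1 := measureReal_le_one
  have h2 : ν.real (Set.Iic t) ≤ 1 := measureReal_le_one
  have h3 : 0 ≤ μ.real (Set.Iic t) := measureReal_nonneg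
  have h4 : 0 ≤ ν.real (Set.Iic t) := measureReal_nonneg
  rw [abs_le]
  constructor <;> linarith

section

variable {Ω : Type*} [MeasurableSpace Ω] {P : Measure Ω}

lemma map_measureReal_Iic {W : Ω → ℝ} (hW : Measurable W) (t : ℝ) :
    (P.map W).real (Set.Iic t) = P.real {ω | W ω ≤ t} :=
  map_measureReal_apply hW measurableSet_Iic

variable [IsProbabilityMeasure P]

lemma measureReal_le_integral_rampDown {W : Ω → ℝ} (hW : Measurable W) {α : ℝ} (hα : 0 < α)
    (z : ℝ) : P.real {ω | W ω ≤ z} ≤ ∫ ω, rampDown z α (W ω) ∂P ∧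
      ∫ ω, rampDown z α (W ω) ∂P ≤ P.real {ω | W ω ≤ z + α} := by
  have hi : ∀ u, Integrable ({ω | W ω ≤ u}.indicator (1 : Ω → ℝ)) P := fun u =>
    (integrable_const (1 : ℝ)).indicator (hW measurableSet_Iic)
  have hr : Integrable (fun ω => rampDown z α (W ω)) P :=
    Integrable.of_bound ((continuous_rampDown z α).measurable.comp hW).aestronglyMeasurable 1
      (Filter.Eventually.of_forall fun ω => by
        rw [Real.norm_eq_abs, abs_of_nonneg (rampDown_nonneg _ _ _)]
        exact rampDown_le_one _ _ _)
  have he : ∀ u, P.real {ω | W ω ≤ u} = ∫ ω, {ω | W ω ≤ u}.indicator (1 : Ω → ℝ) ω ∂P :=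
    fun u => (integral_indicator_one (hW measurableSet_Iic)).symm
  rw [he, he]
  constructor
  · refine integral_mono (hi _) hr fun ω => ?_
    by_cases h : W ω ≤ z
    · simp [h, rampDown_of_le hα h]
    · simp [h, rampDown_nonneg]
  · refine integral_mono hr (hi _) fun ω => ?_
    by_cases h : W ω ≤ z + α
    · simp [h, rampDown_le_one]
    · simp [h, rampDown_of_ge hα (not_le.1 h).le]

/-- The indicator of `(-∞, t]` lies between the ramps starting at `t - α` and `t`; replacing either
by a half-line costs Gaussian mass at most `0.4 α`. -/
lemma abs_measureReal_sub_le_of_rampDown {W : Ω → ℝ} (hW : Measurable W) {α ε : ℝ} (hα : 0 < α)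
    (h : ∀ z, |∫ ω, rampDown z α (W ω) ∂P - ∫ x, rampDown z α x ∂(gaussianReal 0 1)| ≤ ε)
    (t : ℝ) :
    |P.real {ω | W ω ≤ t} - (gaussianReal 0 1).real (Set.Iic t)| ≤ ε + 0.4 * α := by
  have g : ∀ z, (gaussianReal 0 1).real (Set.Iic z) ≤ ∫ x, rampDown z α x ∂(gaussianReal 0 1) ∧
      ∫ x, rampDown z α x ∂(gaussianReal 0 1) ≤ (gaussianReal 0 1).real (Set.Iic (z + α)) :=
    fun z => measureReal_le_integral_rampDown (P := gaussianReal 0 1) measurable_id hα z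
  have w := measureReal_le_integral_rampDown (P := P) hW hα
  have h1 := gaussianReal_real_Iic_le (a := t) (b := t + α) (by linarith)
  have h2 := gaussianReal_real_Iic_le (a := t - α) (b := t) (by linarith)
  have w2 := (w (t - α)).2
  rw [sub_add_cancel] at w2
  rw [abs_le]
  constructor
  · linarith [(abs_le.1 (h (t - α))).1, (g (t - α)).1]
  · linarith [(abs_le.1 (h t)).2, (g t).2, (w t).1]

/-- Stability of the Kolmogorov distance to the Gaussian law under a perturbation that is small
in `L¹`. -/
lemma abs_measureReal_sub_le_of_integral_abs_sub_le {W W' : Ω → ℝ}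
    (hi : Integrable (fun ω => W ω - W' ω) P) {a h Δ : ℝ} (hh : 0 < h)
    (ha : ∫ ω, |W ω - W' ω| ∂P ≤ a)
    (hΔ : ∀ t, |P.real {ω | W' ω ≤ t} - (gaussianReal 0 1).real (Set.Iic t)| ≤ Δ) (t : ℝ) :
    |P.real {ω | W ω ≤ t} - (gaussianReal 0 1).real (Set.Iic t)| ≤ Δ + a / h + 0.4 * h := by
  have hm : P.real {ω | h ≤ |W ω - W' ω|} ≤ a / h := by
    rw [le_div_iff₀ hh, mul_comm]
    exact (mul_meas_ge_le_integral_of_nonneg (Filter.Eventually.of_forall fun _ => abs_nonneg _)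
      hi.abs h).trans ha
  have h1 : P.real {ω | W ω ≤ t} ≤ P.real {ω | W' ω ≤ t + h} + P.real {ω | h ≤ |W ω - W' ω|} := by
    refine (measureReal_mono fun ω hω => ?_).trans (measureReal_union_le _ _)
    by_contra hc
    simp only [Set.mem_union, Set.mem_ofPred_eq, not_or, not_le] at hc hω
    linarith [(abs_lt.1 hc.2).1]
  have h2 : P.real {ω | W' ω ≤ t - h} ≤ P.real {ω | W ω ≤ t} + P.real {ω | h ≤ |W ω - W' ω|} := by
    refine (measureReal_mono fun ω hω => ?_).trans (measureReal_union_le _ _)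
    by_contra hc
    simp only [Set.mem_union, Set.mem_ofPred_eq, not_or, not_le] at hc hω
    linarith [(abs_lt.1 hc.2).2]
  have g1 := gaussianReal_real_Iic_le (a := t) (b := t + h) (by linarith)
  have g2 := gaussianReal_real_Iic_le (a := t - h) (b := t) (by linarith)
  rw [abs_le]
  constructor
  · linarith [(abs_le.1 (hΔ (t - h))).1]
  · linarith [(abs_le.1 (hΔ (t + h))).2]

end

/-! ### The bounded case: a self-bounding inequality -/

/-- A Berry-Esseen bound for sums of bounded centered variables with a dependency graph. -/
theorem IsDependencyGraph.kolmogorovDist_le_of_bounded {V Ω : Type*} [Fintype V]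
    [MeasurableSpace Ω] {P : Measure Ω} [IsProbabilityMeasure P] {G : Multigraph V}
    {X : V → Ω → ℝ} (hX : ∀ i, Measurable (X i)) (hG : IsDependencyGraph G X P) {m : ℕ}
    (hm : ∀ i, (G.nbhd i).card ≤ m) {B : ℝ} (hB0 : 0 ≤ B) (hB : ∀ i ω, |X i ω| ≤ B)
    (h0 : ∀ i, ∫ ω, X i ω ∂P = 0) {θ : ℝ} (hθ0 : 0 < θ) (hθ1 : θ ≤ 1)
    (hb : m * B ≤ 0.1055 * θ) (hx : m ^ 2 * ∑ i, ∫ ω, |X i ω| ^ 3 ∂P ≤ 0.0352 * θ)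
    (hr : |1 - ∫ ω, (∑ i, X i ω) ^ 2 ∂P| ≤ 0.01 * θ) :
    kolmogorovDist (P.map fun ω => ∑ i, X i ω) (gaussianReal 0 1) ≤ 0.65 * θ := by
  have hbd : ∀ i, BddMeasurable (X i) := fun i => ⟨hX i, B, hB i⟩
  have hW : BddMeasurable fun ω => ∑ j, X j ω := BddMeasurable.sum hbd
  have : IsProbabilityMeasure (P.map fun ω => ∑ i, X i ω) :=
    Measure.isProbabilityMeasure_map hW.1.aemeasurable
  set Δ := kolmogorovDist (P.map fun ω => ∑ i, X i ω) (gaussianReal 0 1) with hΔdef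
  have hΔ0 : 0 ≤ Δ := kolmogorovDist_nonneg _ _
  have hΔ : ∀ t, |P.real {ω | ∑ i, X i ω ≤ t} - (gaussianReal 0 1).real (Set.Iic t)| ≤ Δ := by
    intro t
    rw [← map_measureReal_Iic hW.1]
    exact abs_measureReal_Iic_sub_le_kolmogorovDist _ _ t
  set α := 0.14 * θ with hα
  have hα0 : 0 < α := by positivity
  have hstein := hG.abs_integral_rampDown_sub_le hX hm hB0 hB h0 hα0 hΔ
  -- `Δ` occurs on both sides. With `α = 0.14 θ` its coefficient on the right is at most `2 * 0.126
  -- < 1`, so it can be absorbed.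
  have hle : Δ ≤ _ := ciSup_le fun t => by
    rw [map_measureReal_Iic hW.1]
    exact abs_measureReal_sub_le_of_rampDown hW.1 hα0 hstein t
  set b := (m : ℝ) * B with hbdef
  set x := (m : ℝ) ^ 2 * ∑ i, ∫ ω, |X i ω| ^ 3 ∂P with hxdef
  have hb0 : 0 ≤ b := by positivity
  have hx0 : 0 ≤ x := mul_nonneg (by positivity)
    (Finset.sum_nonneg fun i _ => integral_nonneg fun ω => by positivity)
  have hEW : ∫ ω, |∑ j, X j ω| ∂P ≤ 1.01 := by
    refine (integral_abs_le_sqrt_integral_sq (hW.memLp 2)).trans ?_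
    rw [Real.sqrt_le_left (by norm_num)]
    linarith [(abs_le.1 hr).1]
  have hsq : √(b * x) ≤ 0.061 * θ := by
    apply Real.sqrt_le_iff.2 ⟨by positivity, ?_⟩
    calc b * x ≤ (0.1055 * θ) * (0.0352 * θ) := mul_le_mul hb hx hx0 (by positivity)
      _ ≤ (0.061 * θ) ^ 2 := by nlinarith [sq_nonneg θ]
  have h1 : x / 2 * (1.26 + 2 * ∫ ω, |∑ j, X j ω| ∂P + 4 * b) ≤ 0.0176 * θ * 3.71 := by
    refine mul_le_mul (by linarith) (by linarith) ?_ (by positivity)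
    have : 0 ≤ ∫ ω, |∑ j, X j ω| ∂P := integral_nonneg fun _ => abs_nonneg _
    positivity
  have h2 : x / 2 * (1 / α) ≤ 0.126 := by
    rw [mul_one_div, div_le_iff₀ hα0]
    linarith
  have h3 : x / 2 * (1 / α) * (0.4 * (α + 6 * b) + 2 * Δ) ≤
      0.126 * (0.4 * (0.14 * θ + 6 * (0.1055 * θ)) + 2 * Δ) :=
    mul_le_mul h2 (by linarith) (by positivity) (by norm_num)
  have h4 : x / 2 * (1.26 + 2 * ∫ ω, |∑ j, X j ω| ∂P + 4 * b
        + 1 / α * (0.4 * (α + 6 * b) + 2 * Δ))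
      = x / 2 * (1.26 + 2 * ∫ ω, |∑ j, X j ω| ∂P + 4 * b)
        + x / 2 * (1 / α) * (0.4 * (α + 6 * b) + 2 * Δ) := by ring
  rw [h4] at hle
  linarith

/-! ### Truncation: moments and variances -/

/-- Truncation of a real number at level `L`. -/
noncomputable def truncateAt (L x : ℝ) : ℝ := if |x| ≤ L then x else 0

lemma measurable_truncateAt (L : ℝ) : Measurable (truncateAt L) :=
  Measurable.ite (measurableSet_le measurable_id.abs measurable_const) measurable_id
    measurable_const

lemma abs_truncateAt_le {L : ℝ} (hL : 0 ≤ L) (x : ℝ) : |truncateAt L x| ≤ L := by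
  unfold truncateAt
  split_ifs with h
  · exact h
  · simpa using hL

lemma abs_truncateAt_le_abs (L x : ℝ) : |truncateAt L x| ≤ |x| := by
  unfold truncateAt
  split_ifs with h
  · exact le_rfl
  · simp

/-- The remainder is nonzero only for `|x| > L`, where `(|x| / L) ^ n ≤ (|x| / L) ^ δ`. -/
lemma abs_sub_truncateAt_pow_mul_rpow_le {L : ℝ} (hL : 0 < L) {δ : ℝ} {n : ℕ} (hn : n ≠ 0)
    (hδ : n ≤ δ) (x : ℝ) : |x - truncateAt L x| ^ n * L ^ δ ≤ L ^ n * |x| ^ δ := by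
  unfold truncateAt
  split_ifs with h
  · rw [sub_self, abs_zero, zero_pow hn, zero_mul]
    positivity
  · rw [sub_zero]
    have hx : 0 < |x| := hL.trans (not_le.1 h)
    have e : ∀ y : ℝ, 0 < y → y ^ δ = y ^ n * y ^ (δ - n) := fun y hy => by
      rw [← Real.rpow_natCast, ← Real.rpow_add hy]
      congr 1
      ring
    rw [e L hL, e _ hx]
    have h1 : L ^ (δ - n) ≤ |x| ^ (δ - n) :=
      Real.rpow_le_rpow hL.le (not_le.1 h).le (by linarith)
    have h2 : 0 ≤ |x| ^ n * L ^ n := by positivity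
    nlinarith [mul_le_mul_of_nonneg_left h1 h2]

section

variable {Ω : Type*} [MeasurableSpace Ω] {P : Measure Ω} [IsProbabilityMeasure P]

/-- Jensen's inequality, through the tangent line of `t ↦ t³` at the mean. -/
lemma pow_three_integral_abs_le {T : Ω → ℝ} (hT : BddMeasurable T) :
    (∫ ω, |T ω| ∂P) ^ 3 ≤ ∫ ω, |T ω| ^ 3 ∂P := by
  set a := ∫ ω, |T ω| ∂P with ha
  have ha0 : 0 ≤ a := integral_nonneg fun _ => abs_nonneg _
  calc a ^ 3 = ∫ ω, (3 * a ^ 2 * |T ω| - 2 * a ^ 3) ∂P := by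
        rw [integral_sub (hT.abs.integrable.const_mul _) (integrable_const _), integral_const_mul,
          ← ha]
        simp only [integral_const, probReal_univ, one_smul]
        ring
    _ ≤ ∫ ω, |T ω| ^ 3 ∂P := by
        refine integral_mono ((hT.abs.integrable.const_mul _).sub (integrable_const _))
          (hT.abs.pow 3).integrable fun ω => ?_
        have := abs_nonneg (T ω)
        simp only
        nlinarith [mul_nonneg (sq_nonneg (|T ω| - a)) (by linarith : 0 ≤ |T ω| + 2 * a)]

lemma integral_abs_sub_integral_pow_three_le {T : Ω → ℝ} (hT : BddMeasurable T) :
    ∫ ω, |T ω - ∫ ω', T ω' ∂P| ^ 3 ∂P ≤ 8 * ∫ ω, |T ω| ^ 3 ∂P := by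
  set c := ∫ ω', T ω' ∂P with hc
  have hc3 : |c| ^ 3 ≤ ∫ ω, |T ω| ^ 3 ∂P :=
    (pow_le_pow_left₀ (abs_nonneg _) abs_integral_le_integral_abs 3).trans
      (pow_three_integral_abs_le hT)
  calc ∫ ω, |T ω - c| ^ 3 ∂P ≤ ∫ ω, (4 * |T ω| ^ 3 + 4 * |c| ^ 3) ∂P := by
        refine integral_mono ((hT.sub (BddMeasurable.const c)).abs.pow 3).integrable
          (((hT.abs.pow 3).integrable.const_mul 4).add (integrable_const _)) fun ω => ?_
        refine (pow_le_pow_left₀ (abs_nonneg _) (abs_sub (T ω) c) 3).trans ?_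
        nlinarith [mul_nonneg (add_nonneg (abs_nonneg (T ω)) (abs_nonneg c))
          (sq_nonneg (|T ω| - |c|))]
    _ = 4 * ∫ ω, |T ω| ^ 3 ∂P + 4 * |c| ^ 3 := by
        rw [integral_add ((hT.abs.pow 3).integrable.const_mul 4) (integrable_const _),
          integral_const_mul]
        simp
    _ ≤ _ := by linarith

lemma abs_covariance_le_of_abs_le {T R : Ω → ℝ} (hT : BddMeasurable T) {L : ℝ}
    (hL : ∀ ω, |T ω| ≤ L) (hR : MemLp R 2 P) : |cov[T, R; P]| ≤ 2 * L * ∫ ω, |R ω| ∂P := by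
  have hRi : Integrable R P := hR.integrable one_le_two
  rw [covariance_eq_sub (hT.memLp 2) hR]
  have hR0 : 0 ≤ ∫ ω, |R ω| ∂P := integral_nonneg fun _ => abs_nonneg _
  have h1 : |∫ ω, (T * R) ω ∂P| ≤ L * ∫ ω, |R ω| ∂P := by
    rw [← integral_const_mul]
    refine abs_integral_le_integral_abs.trans (integral_mono_of_nonneg
      (Filter.Eventually.of_forall fun _ => abs_nonneg _) (hRi.abs.const_mul L)
      (Filter.Eventually.of_forall fun ω => ?_))
    simp only [Pi.mul_apply, abs_mul]
    exact mul_le_mul_of_nonneg_right (hL ω) (abs_nonneg _)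
  have h2 : |(∫ ω, T ω ∂P) * ∫ ω, R ω ∂P| ≤ L * ∫ ω, |R ω| ∂P := by
    rw [abs_mul]
    have hTL : |∫ ω, T ω ∂P| ≤ L := by
      have := norm_integral_le_of_norm_le_const (μ := P) (f := T) (C := L)
        (Filter.Eventually.of_forall hL)
      simpa using this
    exact mul_le_mul hTL abs_integral_le_integral_abs (abs_nonneg _)
      ((abs_nonneg _).trans hTL)
  exact (abs_sub _ _).trans (by linarith)

end

section

variable {V Ω : Type*} [Fintype V] [MeasurableSpace Ω] {P : Measure Ω} [IsProbabilityMeasure P]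

/-- The change of the variance of a sum along a dependency graph under a perturbation of bounded
variables. -/
lemma abs_variance_sum_add_sub_le {G : Multigraph V} {T R : V → Ω → ℝ}
    (hT : ∀ k, BddMeasurable (T k)) (hR : ∀ k, MemLp (R k) 2 P) {L : ℝ} (hL0 : 0 ≤ L)
    (hL : ∀ k ω, |T k ω| ≤ L) {M : ℝ} (hM : ∀ i, ((G.nbhd i).card : ℝ) ≤ M)
    (hRR : ∀ k l, l ∉ G.nbhd k → cov[R k, R l; P] = 0)
    (hTR : ∀ k l, l ∉ G.nbhd k → cov[T k, R l; P] = 0) :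
    |Var[fun ω => ∑ k, T k ω + ∑ k, R k ω; P] - Var[fun ω => ∑ k, T k ω; P]| ≤
      M * ∑ k, ∫ ω, R k ω ^ 2 ∂P + 4 * M * L * ∑ k, ∫ ω, |R k ω| ∂P := by
  classical
  have hTs : MemLp (fun ω => ∑ k, T k ω) 2 P := (BddMeasurable.sum hT).memLp 2
  have hRs : MemLp (fun ω => ∑ k, R k ω) 2 P := memLp_finsetSum _ fun k _ => hR k
  -- The change is `Var[∑ R] + 2 cov[∑ T, ∑ R]`; only neighbouring pairs contribute, each covariance
  -- costing at most `2 L E|R l|`.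
  have h1 : Var[fun ω => ∑ k, T k ω + ∑ k, R k ω; P] = Var[fun ω => ∑ k, T k ω; P]
      + 2 * cov[fun ω => ∑ k, T k ω, fun ω => ∑ k, R k ω; P] + Var[fun ω => ∑ k, R k ω; P] :=
    variance_add hTs hRs
  have hcard : ∀ k ∈ (Finset.univ : Finset V),
      (((Finset.univ : Finset V).filter fun l => l ∈ G.nbhd k).card : ℝ) ≤ M := by
    intro k _
    simpa using hM k
  have h2 : Var[fun ω => ∑ k, R k ω; P] ≤ M * ∑ k, ∫ ω, R k ω ^ 2 ∂P := by
    refine (variance_sum_le_of_covariance_eq_zero (s := Finset.univ) (fun k _ => hR k)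
      (R := fun k l => l ∈ G.nbhd k) (fun p q => Multigraph.mem_nbhd_comm.1)
      (fun k hk => by convert hcard k hk) fun p _ q _ h => hRR p q h).trans ?_
    rcases isEmpty_or_nonempty V with hV | ⟨⟨i⟩⟩
    · simp
    refine mul_le_mul_of_nonneg_left (Finset.sum_le_sum fun k _ => ?_)
      ((Nat.cast_nonneg _).trans (hM i))
    exact variance_le_expectation_sq (hR k).aestronglyMeasurable
  have h3 : |cov[fun ω => ∑ k, T k ω, fun ω => ∑ k, R k ω; P]|
      ≤ M * ∑ k, 2 * L * ∫ ω, |R k ω| ∂P := by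
    rw [covariance_fun_sum_fun_sum (fun k => (hT k).memLp 2) hR]
    calc _ ≤ ∑ k, ∑ l ∈ G.nbhd k, 2 * L * ∫ ω, |R l ω| ∂P := by
          refine (Finset.abs_sum_le_sum_abs _ _).trans (Finset.sum_le_sum fun k _ => ?_)
          rw [← Finset.sum_subset (Finset.subset_univ (G.nbhd k)) fun l _ hl => hTR k l hl]
          refine (Finset.abs_sum_le_sum_abs _ _).trans (Finset.sum_le_sum fun l _ => ?_)
          exact abs_covariance_le_of_abs_le (hT k) (hL k) (hR l)
      _ ≤ _ := G.sum_sum_nbhd_le (F := fun l => 2 * L * ∫ ω, |R l ω| ∂P) hM fun l => by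
          have : 0 ≤ ∫ ω, |R l ω| ∂P := integral_nonneg fun _ => abs_nonneg _
          positivity
  rw [← Finset.mul_sum] at h3
  have h4 : 0 ≤ Var[fun ω => ∑ k, R k ω; P] := variance_nonneg _ _
  have h5 := abs_le.1 h3
  rw [h1, abs_le]
  constructor <;> linarith [h5.1, h5.2]

end

/-! ### Third moments against moments of order `δ` -/

/-- Bernoulli's inequality: the concave function `u ↦ u ^ (3 / δ)` lies below its tangent at 1,
taken at `u = (t / s) ^ δ`. Being linear in `t ^ δ`, the bound can be integrated and summed. -/
lemma pow_three_le_tangent_rpow {δ s t : ℝ} (hδ : 3 ≤ δ) (hs : 0 < s) (ht : 0 ≤ t) :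
    t ^ 3 ≤ s ^ 3 * (1 + 3 / δ * (t ^ δ / s ^ δ - 1)) := by
  have hδ0 : 0 < δ := by linarith
  have h := rpow_one_add_le_one_add_mul_self (s := (t / s) ^ δ - 1) (p := 3 / δ)
    (by have : 0 ≤ (t / s) ^ δ := by positivity
        linarith) (by positivity) (by rw [div_le_one hδ0]; exact hδ)
  rw [add_sub_cancel, ← Real.rpow_mul (by positivity), mul_div_cancel₀ _ hδ0.ne'] at h
  have e : (t / s) ^ (3 : ℝ) = (t / s) ^ 3 := by exact_mod_cast Real.rpow_natCast (t / s) 3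
  rw [e, div_pow, div_le_iff₀ (by positivity), Real.div_rpow ht hs.le] at h
  linarith

section

variable {V Ω : Type*} [Fintype V] [MeasurableSpace Ω] {P : Measure Ω}

lemma integrable_abs_rpow_of_momentSum_lt_top {Y : V → Ω → ℝ} (hY : ∀ k, Measurable (Y k))
    {c : V → ℝ} {δ : ℝ} (hA : momentSum Y c P δ < ⊤) (k : V) :
    Integrable (fun ω => |Y k ω - c k| ^ δ) P := by
  refine ⟨(((hY k).sub_const _).abs.pow_const δ).aestronglyMeasurable, ?_⟩
  rw [hasFiniteIntegral_iff_ofReal (Filter.Eventually.of_forall fun ω => by positivity)]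
  exact (ENNReal.sum_lt_top.1 hA) k (Finset.mem_univ k)

lemma toReal_momentSum {Y : V → Ω → ℝ} (hY : ∀ k, Measurable (Y k))
    {c : V → ℝ} {δ : ℝ} (hA : momentSum Y c P δ < ⊤) :
    (momentSum Y c P δ).toReal = ∑ k, ∫ ω, |Y k ω - c k| ^ δ ∂P := by
  rw [momentSum, ENNReal.toReal_sum fun k _ => (ENNReal.sum_lt_top.1 hA k (Finset.mem_univ k)).ne]
  refine Finset.sum_congr rfl fun k _ => ?_
  rw [integral_eq_lintegral_of_nonneg_ae (Filter.Eventually.of_forall fun ω => by positivity)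
    (((hY k).sub_const _).abs.pow_const δ).aestronglyMeasurable]

variable [IsProbabilityMeasure P]

lemma integrable_abs_pow_three_of_rpow {Z : Ω → ℝ} (hZ : Measurable Z) {δ : ℝ} (hδ : 3 ≤ δ)
    (hi : Integrable (fun ω => |Z ω| ^ δ) P) : Integrable (fun ω => |Z ω| ^ 3) P := by
  have h : Integrable (fun ω => (1 : ℝ) ^ 3 * (1 + 3 / δ * (|Z ω| ^ δ / 1 ^ δ - 1))) P :=
    ((integrable_const 1).add (((hi.div_const _).sub (integrable_const 1)).const_mul _)).const_mul _
  refine h.mono' (hZ.abs.pow_const 3).aestronglyMeasurable (Filter.Eventually.of_forall fun ω => ?_)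
  rw [Real.norm_eq_abs, abs_of_nonneg (by positivity)]
  exact pow_three_le_tangent_rpow hδ one_pos (abs_nonneg _)

/-- The power mean inequality between third moments and moments of order `δ`. -/
lemma sum_integral_abs_pow_three_le {Z : V → Ω → ℝ} (hZ : ∀ k, Measurable (Z k)) {δ s : ℝ}
    (hδ : 3 ≤ δ) (hi : ∀ k, Integrable (fun ω => |Z k ω| ^ δ) P) (hs : 0 < s)
    (hA : ∑ k, ∫ ω, |Z k ω| ^ δ ∂P = Fintype.card V * s ^ δ) :
    ∑ k, ∫ ω, |Z k ω| ^ 3 ∂P ≤ Fintype.card V * s ^ 3 := by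
  have hsd : (s ^ δ) ≠ 0 := (Real.rpow_pos_of_pos hs _).ne'
  have h : ∀ k, ∫ ω, |Z k ω| ^ 3 ∂P
      ≤ s ^ 3 * (1 + 3 / δ * ((∫ ω, |Z k ω| ^ δ ∂P) / s ^ δ - 1)) := by
    intro k
    have i1 : Integrable (fun ω => 3 / δ * (|Z k ω| ^ δ / s ^ δ - 1)) P :=
      (((hi k).div_const _).sub (integrable_const 1)).const_mul _
    calc ∫ ω, |Z k ω| ^ 3 ∂P ≤ ∫ ω, s ^ 3 * (1 + 3 / δ * (|Z k ω| ^ δ / s ^ δ - 1)) ∂P :=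
          integral_mono (integrable_abs_pow_three_of_rpow (hZ k) hδ (hi k))
            (((integrable_const 1).add i1).const_mul _)
            fun ω => pow_three_le_tangent_rpow hδ hs (abs_nonneg _)
      _ = _ := by
          rw [integral_const_mul, integral_add (integrable_const 1) i1, integral_const_mul,
            integral_sub ((hi k).div_const _) (integrable_const 1), integral_div]
          simp
  refine (Finset.sum_le_sum fun k _ => h k).trans (le_of_eq ?_)
  rw [← Finset.mul_sum, Finset.sum_add_distrib, ← Finset.mul_sum, Finset.sum_sub_distrib,
    ← Finset.sum_div, hA, mul_div_cancel_right₀ _ hsd]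
  simp [mul_comm]

/-! ### The general case by truncation -/

/-- A Berry-Esseen bound for sums along a dependency graph under a moment condition, obtained by
truncation at the level `e * v / m`. -/
theorem IsDependencyGraph.kolmogorovDist_normalizedSum_le {Y : V → Ω → ℝ}
    (hY : ∀ k, Measurable (Y k)) {G : Multigraph V} (hG : IsDependencyGraph G Y P) {m : ℕ}
    (hm0 : 0 < m) (hm : ∀ i, (G.nbhd i).card ≤ m) {c : V → ℝ} {δ : ℝ} (hδ : 3 ≤ δ)
    (hi : ∀ k, Integrable (fun ω => |Y k ω - c k| ^ δ) P) {v : ℝ} (hv0 : 0 < v)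
    (hv : sumStdDev Y P = v) {e y θ : ℝ} (he : 0 < e)
    (hA : ∑ k, ∫ ω, |Y k ω - c k| ^ δ ∂P = m * e * (e * v / m) ^ δ)
    (hy : m ^ 2 * ∑ k, ∫ ω, |Y k ω - c k| ^ 3 ∂P ≤ y * v ^ 3) (hθ1 : θ ≤ 1)
    (heθ : 18.96 * e ≤ θ) (hyθ : 227.5 * y ≤ θ) :
    kolmogorovDist (P.map (normalizedSum Y P)) (gaussianReal 0 1) ≤ θ := by
  have hm0' : (0 : ℝ) < m := Nat.cast_pos.2 hm0
  have hM : ∀ i, ((G.nbhd i).card : ℝ) ≤ m := fun i => Nat.cast_le.2 (hm i)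
  have hθ0 : 0 < θ := by linarith
  set L := e * v / m with hL
  have hL0 : 0 < L := by positivity
  have hLm : m * L = e * v := by rw [hL]; field_simp
  have hLδ : 0 < L ^ δ := Real.rpow_pos_of_pos hL0 _
  set T : V → Ω → ℝ := fun k ω => truncateAt L (Y k ω - c k) with hT
  set R : V → Ω → ℝ := fun k ω => (Y k ω - c k) - truncateAt L (Y k ω - c k) with hR
  have hZm : ∀ k, Measurable fun ω => Y k ω - c k := fun k => (hY k).sub_const _
  have hTL : ∀ k ω, |T k ω| ≤ L := fun k ω => abs_truncateAt_le hL0.le _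
  have hTb : ∀ k, BddMeasurable (T k) :=
    fun k => ⟨(measurable_truncateAt L).comp (hZm k), L, hTL k⟩
  have hRm : ∀ k, Measurable (R k) := fun k => (hZm k).sub ((measurable_truncateAt L).comp (hZm k))
  have hRle : ∀ n : ℕ, n ≠ 0 → (n : ℝ) ≤ δ → ∀ k ω,
      |R k ω| ^ n ≤ L ^ n / L ^ δ * |Y k ω - c k| ^ δ := by
    intro n hn hnδ k ω
    rw [div_mul_eq_mul_div, le_div_iff₀ hLδ]
    exact abs_sub_truncateAt_pow_mul_rpow_le hL0 hn hnδ _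
  have hRsum : ∀ n : ℕ, n ≠ 0 → (n : ℝ) ≤ δ →
      ∑ k, ∫ ω, |R k ω| ^ n ∂P ≤ L ^ n * (m * e) := by
    intro n hn hnδ
    calc ∑ k, ∫ ω, |R k ω| ^ n ∂P ≤ ∑ k, ∫ ω, L ^ n / L ^ δ * |Y k ω - c k| ^ δ ∂P := by
          refine Finset.sum_le_sum fun k _ => integral_mono_of_nonneg
            (Filter.Eventually.of_forall fun ω => by positivity) ((hi k).const_mul _)
            (Filter.Eventually.of_forall (hRle n hn hnδ k))
      _ = L ^ n * (m * e) := by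
          simp_rw [integral_const_mul]
          rw [← Finset.mul_sum, hA]
          field_simp
  have hR2 : ∀ k, MemLp (R k) 2 P := by
    intro k
    rw [memLp_two_iff_integrable_sq (hRm k).aestronglyMeasurable]
    refine ((hi k).const_mul (L ^ 2 / L ^ δ)).mono' ((hRm k).pow_const 2).aestronglyMeasurable
      (Filter.Eventually.of_forall fun ω => ?_)
    rw [Real.norm_eq_abs, abs_pow]
    exact hRle 2 two_ne_zero (by norm_num; linarith) k ω
  have hRi : ∀ k, Integrable (R k) P := fun k => (hR2 k).integrable one_le_two
  have hR1s : ∑ k, ∫ ω, |R k ω| ∂P ≤ e ^ 2 * v := by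
    have := hRsum 1 one_ne_zero (by norm_num; linarith)
    simp only [pow_one] at this
    calc _ ≤ _ := this
      _ = e * (m * L) := by ring
      _ = e ^ 2 * v := by rw [hLm]; ring
  have hR2s : m * ∑ k, ∫ ω, R k ω ^ 2 ∂P ≤ e ^ 3 * v ^ 2 := by
    have := hRsum 2 two_ne_zero (by norm_num; linarith)
    simp only [sq_abs] at this
    calc m * ∑ k, ∫ ω, R k ω ^ 2 ∂P ≤ m * (L ^ 2 * (m * e)) := by gcongr
      _ = e * (m * L) ^ 2 := by ring
      _ = e ^ 3 * v ^ 2 := by rw [hLm]; ring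
  -- the total sum in terms of the truncated variables
  have hSdec : totalSum Y = fun ω => (∑ k, T k ω + ∑ k, R k ω) + ∑ k, c k := by
    ext ω
    simp only [totalSum, hT, hR]
    rw [← Finset.sum_add_distrib, ← Finset.sum_add_distrib]
    refine Finset.sum_congr rfl fun k _ => ?_
    ring
  have hTs : BddMeasurable fun ω => ∑ k, T k ω := BddMeasurable.sum hTb
  have hRs : Integrable (fun ω => ∑ k, R k ω) P := integrable_finsetSum _ fun k _ => hRi k
  have hvar : Var[fun ω => ∑ k, T k ω + ∑ k, R k ω; P] = v ^ 2 := by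
    rw [← hv, sumStdDev, Real.sq_sqrt (variance_nonneg _ _), hSdec]
    exact (variance_add_const (hTs.integrable.add hRs).aestronglyMeasurable _).symm
  -- the normalized truncated variables
  set X : V → Ω → ℝ := fun k ω => (T k ω - ∫ ω', T k ω' ∂P) / v with hX
  have hGX : IsDependencyGraph G X P := by
    refine hG.comp (g := fun k x => (truncateAt L (x - c k) - ∫ ω', T k ω' ∂P) / v) fun k => ?_
    exact (((measurable_truncateAt L).comp (measurable_id.sub_const _)).sub_const _).div_const _
  have hXm : ∀ k, Measurable (X k) := fun k => ((hTb k).1.sub_const _).div_const _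
  have hXB : ∀ k ω, |X k ω| ≤ 2 * L / v := by
    intro k ω
    rw [hX, abs_div, abs_of_pos hv0]
    have hTi : |∫ ω', T k ω' ∂P| ≤ L := by
      have := norm_integral_le_of_norm_le_const (μ := P) (f := T k) (C := L)
        (Filter.Eventually.of_forall (hTL k))
      simpa using this
    have := (abs_sub (T k ω) (∫ ω', T k ω' ∂P)).trans (add_le_add (hTL k ω) hTi)
    exact div_le_div_of_nonneg_right (by linarith) hv0.le
  have hX0 : ∀ k, ∫ ω, X k ω ∂P = 0 := by
    intro k
    rw [hX, integral_div, integral_sub (hTb k).integrable (integrable_const _)]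
    simp
  have hX3 : m ^ 2 * ∑ k, ∫ ω, |X k ω| ^ 3 ∂P ≤ 8 * y := by
    have h1 : ∀ k, ∫ ω, |X k ω| ^ 3 ∂P ≤ 8 / v ^ 3 * ∫ ω, |Y k ω - c k| ^ 3 ∂P := by
      intro k
      have e1 : ∀ ω, |X k ω| ^ 3 = |T k ω - ∫ ω', T k ω' ∂P| ^ 3 / v ^ 3 := fun ω => by
        rw [hX, abs_div, abs_of_pos hv0, div_pow]
      simp_rw [e1]
      rw [integral_div, div_mul_eq_mul_div]
      refine div_le_div_of_nonneg_right ?_ (by positivity)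
      refine (integral_abs_sub_integral_pow_three_le (hTb k)).trans ?_
      refine mul_le_mul_of_nonneg_left (integral_mono ((hTb k).abs.pow 3).integrable
        (integrable_abs_pow_three_of_rpow (hZm k) hδ (hi k)) fun ω => ?_) (by norm_num)
      exact pow_le_pow_left₀ (abs_nonneg _) (abs_truncateAt_le_abs _ _) 3
    calc m ^ 2 * ∑ k, ∫ ω, |X k ω| ^ 3 ∂P
        ≤ m ^ 2 * ∑ k, 8 / v ^ 3 * ∫ ω, |Y k ω - c k| ^ 3 ∂P := by
          gcongr with k _
          exact h1 k
      _ = 8 / v ^ 3 * (m ^ 2 * ∑ k, ∫ ω, |Y k ω - c k| ^ 3 ∂P) := by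
          rw [← Finset.mul_sum]
          ring
      _ ≤ 8 / v ^ 3 * (y * v ^ 3) := by gcongr
      _ = 8 * y := by field_simp
  have hXsum : ∀ ω, ∑ k, X k ω = (∑ k, T k ω - ∫ ω', ∑ k, T k ω' ∂P) / v := by
    intro ω
    rw [integral_finsetSum _ fun k _ => (hTb k).integrable, ← Finset.sum_sub_distrib,
      ← Finset.sum_div]
  -- The truncated sum is divided by the original `v`, so its variance is not exactly 1. The factor
  -- 5 is 1 from the variance of the remainder plus 4 from the covariance.
  have hXvar : |1 - ∫ ω, (∑ k, X k ω) ^ 2 ∂P| ≤ 5 * e ^ 3 := by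
    have e1 : ∫ ω, (∑ k, X k ω) ^ 2 ∂P = Var[fun ω => ∑ k, T k ω; P] / v ^ 2 := by
      simp_rw [hXsum, div_pow]
      rw [integral_div, variance_eq_integral hTs.1.aemeasurable]
    have hind : ∀ k l, l ∉ G.nbhd k → IndepFun (Y k) (Y l) P := fun k l h => hG.indepFun h
    have htm : ∀ k, Measurable fun x => truncateAt L (x - c k) := fun k =>
      (measurable_truncateAt L).comp (measurable_id.sub_const _)
    have hrm : ∀ k, Measurable fun x => (x - c k) - truncateAt L (x - c k) := fun k =>
      (measurable_id.sub_const _).sub (htm k)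
    have h1 := abs_variance_sum_add_sub_le hTb hR2 hL0.le hTL hM
      (fun k l h => ((hind k l h).comp (hrm k) (hrm l)).covariance_eq_zero (hR2 k) (hR2 l))
      (fun k l h => ((hind k l h).comp (htm k) (hrm l)).covariance_eq_zero ((hTb k).memLp 2)
        (hR2 l))
    rw [hvar] at h1
    have h2 : 4 * m * L * ∑ k, ∫ ω, |R k ω| ∂P ≤ 4 * e ^ 3 * v ^ 2 := by
      calc 4 * m * L * ∑ k, ∫ ω, |R k ω| ∂P ≤ 4 * m * L * (e ^ 2 * v) := by gcongr
        _ = 4 * (m * L) * (e ^ 2 * v) := by ring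
        _ = 4 * e ^ 3 * v ^ 2 := by rw [hLm]; ring
    rw [e1, show 1 - Var[fun ω => ∑ k, T k ω; P] / v ^ 2
      = (v ^ 2 - Var[fun ω => ∑ k, T k ω; P]) / v ^ 2 by field_simp, abs_div,
      abs_of_pos (by positivity : 0 < v ^ 2), div_le_iff₀ (by positivity)]
    linarith
  have he1 : e ≤ 1 / 18.96 := by rw [le_div_iff₀ (by norm_num)]; linarith
  have he3 : 5 * e ^ 3 ≤ 0.01 * θ := by
    have : e ^ 2 ≤ (1 / 18.96) ^ 2 := pow_le_pow_left₀ he.le he1 2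
    have h2 : e ^ 3 = e ^ 2 * e := by ring
    rw [h2]
    nlinarith
  -- Here `m B = 2 e` and the third moment term is at most `8 y`; `2 / 18.96 ≤ 0.1055` and `8 /
  -- 227.5 ≤ 0.0352` fit the bounded case.
  have hbounded := hGX.kolmogorovDist_le_of_bounded hXm hm (by positivity) hXB hX0 hθ0 hθ1
    (by
      have : m * (2 * L / v) = 2 * e := by
        rw [mul_div_assoc', mul_left_comm, hLm]
        field_simp
      rw [this]
      linarith) (hX3.trans (by linarith)) (hXvar.trans he3)
  -- comparison of the two normalized sums
  have hXs : Measurable fun ω => ∑ k, X k ω := Finset.measurable_sum _ fun k _ => hXm k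
  have hWm : Measurable (normalizedSum Y P) :=
    ((Finset.measurable_sum _ fun k _ => hY k).sub_const _).div_const _
  have hdiff : ∀ ω, normalizedSum Y P ω - ∑ k, X k ω
      = (∑ k, (R k ω - ∫ ω', R k ω' ∂P)) / v := by
    intro ω
    have hTRs : Integrable (fun ω => ∑ k, T k ω + ∑ k, R k ω) P := hTs.integrable.add hRs
    rw [hXsum, normalizedSum, hv, hSdec, integral_add hTRs (integrable_const _),
      integral_add hTs.integrable hRs, Finset.sum_sub_distrib,
      ← integral_finsetSum _ fun k _ => hRi k]
    simp only [integral_const, probReal_univ, one_smul]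
    ring
  have hdi : ∀ k, Integrable (fun ω => R k ω - ∫ ω', R k ω' ∂P) P :=
    fun k => (hRi k).sub (integrable_const _)
  have hdiffi : Integrable (fun ω => normalizedSum Y P ω - ∑ k, X k ω) P := by
    simp_rw [hdiff]
    exact (integrable_finsetSum _ fun k _ => hdi k).div_const _
  have hdiff1 : ∫ ω, |normalizedSum Y P ω - ∑ k, X k ω| ∂P ≤ 2 * e ^ 2 := by
    simp_rw [hdiff, abs_div, abs_of_pos hv0]
    rw [integral_div, div_le_iff₀ hv0]
    calc ∫ ω, |∑ k, (R k ω - ∫ ω', R k ω' ∂P)| ∂P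
        ≤ ∫ ω, ∑ k, (|R k ω| + ∫ ω', |R k ω'| ∂P) ∂P := by
          refine integral_mono (integrable_finsetSum _ fun k _ => hdi k).abs
            (integrable_finsetSum _ fun k _ => (hRi k).abs.add (integrable_const _)) fun ω => ?_
          refine (Finset.abs_sum_le_sum_abs _ _).trans (Finset.sum_le_sum fun k _ => ?_)
          exact (abs_sub _ _).trans (add_le_add le_rfl abs_integral_le_integral_abs)
      _ = ∑ k, 2 * ∫ ω, |R k ω| ∂P := by
          rw [integral_finsetSum (f := fun k ω => |R k ω| + ∫ ω', |R k ω'| ∂P) _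
            fun k _ => (hRi k).abs.add (integrable_const _)]
          refine Finset.sum_congr rfl fun k _ => ?_
          rw [integral_add (hRi k).abs (integrable_const _)]
          simp [two_mul]
      _ ≤ 2 * e ^ 2 * v := by
          rw [← Finset.mul_sum]
          linarith
  have : IsProbabilityMeasure (P.map fun ω => ∑ k, X k ω) :=
    Measure.isProbabilityMeasure_map hXs.aemeasurable
  have hXK : ∀ t, |P.real {ω | ∑ k, X k ω ≤ t} - (gaussianReal 0 1).real (Set.Iic t)|
      ≤ 0.65 * θ := by
    intro t
    rw [← map_measureReal_Iic hXs]
    exact (abs_measureReal_Iic_sub_le_kolmogorovDist _ _ t).trans hbounded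
  refine ciSup_le fun t => ?_
  rw [map_measureReal_Iic hWm]
  -- Markov's inequality at level `2 e` against the `L¹` bound `2 e²` costs `e`, the Gaussian shift
  -- `0.8 e`; together `1.8 e ≤ 0.35 θ`.
  refine (abs_measureReal_sub_le_of_integral_abs_sub_le hdiffi (by positivity : 0 < 2 * e) hdiff1
    hXK t).trans ?_
  rw [show 2 * e ^ 2 / (2 * e) = e by field_simp]
  linarith

/-- If the sum vanished, each `Y k` would equal `c k` almost surely and `S` would have variance
zero. -/
lemma sum_integral_abs_rpow_pos {Y : V → Ω → ℝ} {c : V → ℝ} {δ : ℝ}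
    (hi : ∀ k, Integrable (fun ω => |Y k ω - c k| ^ δ) P) (hδ : 0 < δ)
    (hv : 0 < sumStdDev Y P) : 0 < ∑ k, ∫ ω, |Y k ω - c k| ^ δ ∂P := by
  have hnn : ∀ k, 0 ≤ ∫ ω, |Y k ω - c k| ^ δ ∂P := fun k => integral_nonneg fun ω => by positivity
  refine (Finset.sum_nonneg fun k _ => hnn k).lt_of_ne' fun h0 => ?_
  rw [Finset.sum_eq_zero_iff_of_nonneg fun k _ => hnn k] at h0
  have hae : ∀ᵐ ω ∂P, ∀ k, Y k ω = c k := by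
    rw [ae_all_iff]
    intro k
    have h := (integral_eq_zero_iff_of_nonneg (fun ω => by positivity) (hi k)).1
      (h0 k (Finset.mem_univ k))
    filter_upwards [h] with ω hω
    have h1 := (Real.rpow_eq_zero (abs_nonneg _) hδ.ne').1 hω
    linarith [abs_eq_zero.1 h1]
  have hS : totalSum Y =ᵐ[P] fun _ => ∑ k, c k := by
    filter_upwards [hae] with ω hω
    exact Finset.sum_congr rfl fun k _ => hω k
  rw [sumStdDev, variance_congr hS] at hv
  simp [variance_eq_integral] at hv

end

/-! ### Choice of parameters and conclusion -/

/-- With `M = D + 1`, the first identity says that the first term of the maximum is 18.96 times the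
solution `e` of the truncation balance, the second that the other term is 227.5 times the power mean
bound for the third moment ratio. Logarithms turn both into identities linear in `log N`, `log A`,
`log v` and `log M`. -/
lemma bound_parameter_identities {N A v M δ : ℝ} (hN : 0 < N) (hA : 0 < A) (hv : 0 < v)
    (hM : 0 < M) (hδ : 0 < δ) {ξ : ℝ} (hξ : ξ = (N / A) ^ (1 / δ) * √(v ^ 2 / (N * M))) :
    0 < ξ ∧ (∀ e, e = ξ ^ (-(δ / (δ + 1))) * (M / N) ^ ((δ - 2) / (2 * (δ + 1))) →
      A = M * e * (e * v / M) ^ δ) ∧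
    M ^ 2 * (N * ((A / N) ^ (1 / δ)) ^ 3) = 1 / ξ ^ 3 * √(M / N) * v ^ 3 := by
  have hξ0 : 0 < ξ := by rw [hξ]; positivity
  have hlog : Real.log ξ = 1 / δ * (Real.log N - Real.log A)
      + 1 / 2 * (2 * Real.log v - (Real.log N + Real.log M)) := by
    rw [hξ, Real.sqrt_eq_rpow, Real.log_mul (by positivity) (by positivity),
      Real.log_rpow (by positivity), Real.log_rpow (by positivity),
      Real.log_div hN.ne' hA.ne', Real.log_div (by positivity) (by positivity),
      Real.log_mul hN.ne' hM.ne', Real.log_pow]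
    norm_num
  refine ⟨hξ0, fun e he => ?_, ?_⟩
  · have he0 : 0 < e := by rw [he]; positivity
    have hloge : Real.log e = -(δ / (δ + 1)) * Real.log ξ
        + (δ - 2) / (2 * (δ + 1)) * (Real.log M - Real.log N) := by
      rw [he, Real.log_mul (by positivity) (by positivity), Real.log_rpow hξ0,
        Real.log_rpow (by positivity), Real.log_div hM.ne' hN.ne']
    refine Real.log_injOn_pos (Set.mem_Ioi.2 hA) (Set.mem_Ioi.2 (by positivity)) ?_
    rw [Real.log_mul (by positivity) (by positivity), Real.log_mul hM.ne' he0.ne',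
      Real.log_rpow (by positivity), Real.log_div (by positivity) hM.ne',
      Real.log_mul he0.ne' hv.ne', hloge, hlog]
    field_simp
    ring
  · refine Real.log_injOn_pos (Set.mem_Ioi.2 (by positivity)) (Set.mem_Ioi.2 (by positivity)) ?_
    rw [Real.log_mul (by positivity) (by positivity), Real.log_mul hN.ne' (by positivity),
      Real.log_mul (by positivity) (by positivity), Real.log_mul (by positivity) (by positivity),
      Real.sqrt_eq_rpow, Real.log_rpow (by positivity), one_div (ξ ^ 3), Real.log_inv,
      Real.log_pow, Real.log_pow, Real.log_pow, Real.log_pow, Real.log_rpow (by positivity),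
      Real.log_div hA.ne' hN.ne', Real.log_div hM.ne' hN.ne', hlog]
    push_cast
    field_simp
    ring

theorem mainTheorem2 {V Ω : Type*} [Fintype V] [MeasurableSpace Ω]
    (P : Measure Ω) [IsProbabilityMeasure P]
    (Y : V → Ω → ℝ) (hY : ∀ k, Measurable (Y k))
    (G : Multigraph V) (hG : IsDependencyGraph G Y P)
    (D : ℕ) (hD : G.maxDegree = D)
    (c : V → ℝ) (δ : ℝ) (hδ : 3 ≤ δ)
    (hv : 0 < sumStdDev Y P) (hA : momentSum Y c P δ < ⊤) :
    kolmogorovDist (P.map (normalizedSum Y P)) (gaussianReal 0 1) ≤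
      max
        (18.96 * renormStdDev Y c P D δ ^ (-(δ / (δ + 1))) *
          (((D : ℝ) + 1) / (Fintype.card V : ℝ)) ^ ((δ - 2) / (2 * (δ + 1))))
        (227.5 / renormStdDev Y c P D δ ^ 3 * √(((D : ℝ) + 1) / (Fintype.card V : ℝ))) := by
  have hi := integrable_abs_rpow_of_momentSum_lt_top hY hA
  have hδ0 : 0 < δ := by linarith
  have hA0 := sum_integral_abs_rpow_pos hi hδ0 hv
  have hN : Nonempty V := by
    by_contra h
    rw [not_nonempty_iff] at h
    simp at hA0
  have hN0 : (0 : ℝ) < Fintype.card V := Nat.cast_pos.2 Fintype.card_pos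
  have hM0 : (0 : ℝ) < (D : ℝ) + 1 := by positivity
  have hvar : variance (totalSum Y) P = sumStdDev Y P ^ 2 :=
    (Real.sq_sqrt (variance_nonneg _ _)).symm
  set A := ∑ k, ∫ ω, |Y k ω - c k| ^ δ ∂P with hAdef
  obtain ⟨hξ0, hE, hy⟩ := bound_parameter_identities (ξ := renormStdDev Y c P D δ) hN0 hA0 hv hM0
    hδ0 (by rw [renormStdDev, toReal_momentSum hY hA, hvar])
  set ξ := renormStdDev Y c P D δ with hξ
  set v := sumStdDev Y P with hvdef
  set e := ξ ^ (-(δ / (δ + 1))) * (((D : ℝ) + 1) / (Fintype.card V : ℝ)) ^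
    ((δ - 2) / (2 * (δ + 1))) with he
  have he0 : 0 < e := by positivity
  set y := 1 / ξ ^ 3 * √(((D : ℝ) + 1) / (Fintype.card V : ℝ)) with hydef
  have hgoal : max
        (18.96 * ξ ^ (-(δ / (δ + 1))) *
          (((D : ℝ) + 1) / (Fintype.card V : ℝ)) ^ ((δ - 2) / (2 * (δ + 1))))
        (227.5 / ξ ^ 3 * √(((D : ℝ) + 1) / (Fintype.card V : ℝ)))
      = max (18.96 * e) (227.5 * y) := by
    rw [he, hydef]
    congr 1 <;> ring
  rw [hgoal]
  have hWm : Measurable (normalizedSum Y P) :=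
    ((Finset.measurable_sum _ fun k _ => hY k).sub_const _).div_const _
  have : IsProbabilityMeasure (P.map (normalizedSum Y P)) :=
    Measure.isProbabilityMeasure_map hWm.aemeasurable
  -- The bounded case needs `θ ≤ 1`; otherwise the distance is trivially at most 1.
  rcases le_total 1 (max (18.96 * e) (227.5 * y)) with h1 | h1
  · exact (kolmogorovDist_le_one _ _).trans h1
  have hs : 0 < (A / Fintype.card V) ^ (1 / δ) := by positivity
  have h3 := sum_integral_abs_pow_three_le (fun k => (hY k).sub_const (c k)) hδ hi hs (by
    rw [← Real.rpow_mul (by positivity), one_div_mul_cancel hδ0.ne', Real.rpow_one,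
      mul_div_cancel₀ _ hN0.ne'])
  refine hG.kolmogorovDist_normalizedSum_le hY (Nat.succ_pos D) (fun i => hD ▸ G.card_nbhd_le i)
    hδ hi hv rfl he0 (y := y) ?_ ?_ h1 (le_max_left _ _) (le_max_right _ _)
  · push_cast
    exact hE e rfl
  · push_cast
    rw [← hy]
    gcongr
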